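/- **Setting.** Let $\mathcal S,\mathcal A$ be finite nonempty sets, $\gamma\in(0,1)$ and $\lambda>0$. An MDP $\mathcal M=(r,P,\mu)$ consists of rewards $r:\mathcal S\times\mathcal A\to\mathbb R$, transition probabilities $P(\cdot;s,a)$ on $\mathcal S$ and an initial distribution $\mu$ on $\mathcal S$. For a policy $\pi$ (a probability vector $\pi(\cdot;s)$ on $\mathcal A$ for each $s$) put $H(\pi;s)=-\sum_a\pi(a;s)\log\pi(a;s)$ and $$J_\lambda(\pi)=\mathbb E_{s_0\sim\mu}\,\mathbb E^\pi\Big[\sum_{t\ge0}\gamma^t\big(r(s_t,a_t)+\lambda H(\pi;s_t)\big)\Big].$$ Write $\|\pi-\pi'\|_\infty=\max_{s,a}|\pi(a;s)-\pi'(a;s)|$. *Soft Q-learning* with behavioural policy $\pi_B$ and step sizes $(\alpha_t)_{t\ge0}$ starts from $Q_0=0$ and a state $s_0$ drawn from an arbitrary distribution $\rho$. At iteration $t$ it samples $a_t\sim\pi_B(\cdot;s_t)$ and $s_{t+1}\sim P(\cdot;s_t,a_t)$ and sets $$Q_{t+1}(s_t,a_t)=Q_t(s_t,a_t)+\alpha_t\Big(r(s_t,a_t)+\gamma\lambda\log\sum_{a'}e^{Q_t(s_{t+1},a')/\lambda}-Q_t(s_t,a_t)\Big),$$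 leaving the other entries unchanged. After $n$ iterations it returns $\pi^o_n(a;s)=e^{Q_n(s,a)/\lambda}/\sum_{a'}e^{Q_n(s,a')/\lambda}$. The expectation over this randomness is $\mathbb E_o$. The policy $\pi_B$ is called *ergodic* for $\mathcal M$ if the Markov chain of state-action pairs $(s_t,a_t)$ it induces is irreducible and aperiodic. For reals $h,t_0,C$ we say that *the rate holds with $(h,t_0,C)$* if, with $\alpha_t=h/(t+t_0)$, for every $\rho$ and every $\delta\in(0,1)$ there is an integer $T\ge 0$ with $$T\le C\,\frac{\log(1/\delta)}{\delta^2}\qquad\text{and}\qquad \mathbb E_o\big[\|\pi^*-\pi^o_n\|_\infty^2\big]\le\delta^2\ \text{ for all } n\ge T .$$ **Proposition.** 1. Let $\pi_B$ be ergodic for $\mathcal M$. Then $J_\lambda$ has a unique maximizer $\pi^*$, and for all sufficiently large $h$ and all $t_0$ sufficiently large (depending on $h$) there is a $C$ such that the rate holds with $(h,t_0,C)$. 2. The thresholds for $h$ and $t_0$ and the constant $C$ can be chosen uniformly: for given $\mathcal S,\mathcal A,\gamma,\lambda$, $\overline R$, $m>0$, $\mathfrak t\in\mathbb N$ the same thresholds,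 and for each admissible $(h,t_0)$ the same $C$, serve all $\mathcal M$ and all ergodic $\pi_B$ such that $|r|\le\overline R$, the stationary distribution of the pair chain is at least $m$ everywhere, and its mixing time (to total variation distance $1/4$) is at most $\mathfrak t$. 3. Consequently soft Q-learning is an inexact oracle: for any family $(\mathcal M_{x,\xi})$ of such MDPs, indexed by decisions $x$ and contexts $\xi$, with behavioural policies ergodic for each $(x,\xi)$, and with $\pi^*_{x,\xi}$ the unique maximizer of the objective of $\mathcal M_{x,\xi}$, there are $h_{x,\xi},t_{0,x,\xi}>0$ and $C_{x,\xi}$ such that for all initial state distributions and every $\delta\in(0,1)$ there are iteration numbers $T_{x,\xi}\le C_{x,\xi}\log(1/\delta)/\delta^2$ for which the returned policies $\pi^o_{x,\xi}$ satisfy $\mathbb E_o\big[\|\pi^*_{x,\xi}-\pi^o_{x,\xi}\|_\infty^2\big]\le\delta^2$ for all $x,\xi$. -/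

import Mathlib

/-- The data of a finite Markov decision process besides the discount factor: rewards, transition
probabilities and initial state distribution. -/
structure MDP (S A : Type*) [Fintype S] where
  r : S → A → ℝ
  P : S → A → stdSimplex ℝ S
  μ : stdSimplex ℝ S

/-- A (stationary, randomized) policy; `π s a` is the probability of action `a` in state `s`. -/
abbrev Policy (S A : Type*) [Fintype A] := S → stdSimplex ℝ A

/-- The supremum norm `max_{s,a} |π s a - π' s a|`. -/
noncomputable def policyDist {S A : Type*} [Fintype S] [Fintype A] (π π' : Policy S A) : ℝ :=
  ‖fun (s : S) (a : A) => π s a - π' s a‖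

section Objective

variable {S A : Type*} [Fintype S] [DecidableEq S] [Fintype A]

/-- The entropy `H(π; s) = - ∑ a, π s a * log (π s a)`. -/
noncomputable def entropy (π : Policy S A) (s : S) : ℝ := ∑ a, Real.negMulLog (π s a)

/-- The transition matrix on states under the policy `π`. -/
noncomputable def stateMatrix (M : MDP S A) (π : Policy S A) : Matrix S S ℝ :=
  fun s s' => ∑ a, π s a * M.P s a s'

/-- The entropy-regularized value function
`V s = ∑ t, γ ^ t * E[r (s_t, a_t) + lam * H (π; s_t) | s_0 = s]`; the law of `s_t` is the `s`-th row
of the `t`-th power of the transition matrix. -/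
noncomputable def valueFn (M : MDP S A) (γ lam : ℝ) (π : Policy S A) (s : S) : ℝ :=
  ∑' t : ℕ, γ ^ t *
    ∑ s', (stateMatrix M π ^ t) s s' * (∑ a, π s' a * M.r s' a + lam * entropy π s')

/-- The follower's objective: the value averaged over the initial state distribution. -/
noncomputable def objective (M : MDP S A) (γ lam : ℝ) (π : Policy S A) : ℝ :=
  ∑ s, M.μ s * valueFn M γ lam π s

/-- `π` is the unique maximizer of the follower's objective over all policies. -/
def IsUniqueOptimal (M : MDP S A) (γ lam : ℝ) (π : Policy S A) : Prop :=
  (∀ π', objective M γ lam π' ≤ objective M γ lam π) ∧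
    ∀ π', (∀ π'', objective M γ lam π'' ≤ objective M γ lam π') → π' = π

end Objective

section Chain

variable {S A : Type*} [Fintype S] [Fintype A]

/-- The transition matrix of the Markov chain of state-action pairs `(s_t, a_t)` induced by the
policy `π`. -/
def pairMatrix (M : MDP S A) (π : Policy S A) : Matrix (S × A) (S × A) ℝ :=
  fun i j => M.P i.1 i.2 j.1 * π j.1 j.2

variable {I : Type*} [Fintype I] [DecidableEq I]

/-- Every state has period one: the return times with positive probability have gcd `1`. -/
def IsAperiodic (K : Matrix I I ℝ) : Prop :=
  ∀ i, ∀ d : ℕ, (∀ n : ℕ, 0 < n → 0 < (K ^ n) i i → d ∣ n) → d = 1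

/-- A finite Markov chain is ergodic if it is irreducible and aperiodic. -/
def IsErgodicChain (K : Matrix I I ℝ) : Prop := K.IsIrreducible ∧ IsAperiodic K

/-- The chain has a stationary distribution all of whose entries are at least `m`, and its mixing
time is at most `τ`: after `τ` steps the law from any starting point is within total variation
distance `1 / 4` of the stationary distribution. -/
def HasMixing (K : Matrix I I ℝ) (m : ℝ) (τ : ℕ) : Prop :=
  ∃ ν : stdSimplex ℝ I, (∀ j, ∑ i, ν i * K i j = ν j) ∧ (∀ i, m ≤ ν i) ∧
    ∀ i, (1 / 2 : ℝ) * ∑ j, |(K ^ τ) i j - ν j| ≤ 1 / 4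

end Chain

section SoftQLearning

variable {S A : Type*} [Fintype S] [Fintype A]

/-- The trajectories `s_0, a_0, s_1, a_1, …, a_{n-1}, s_n`. -/
abbrev Traj (S A : Type*) (n : ℕ) := (Fin (n + 1) → S) × (Fin n → A)

/-- The trajectory without its last transition. -/
def Traj.init {n : ℕ} (ω : Traj S A (n + 1)) : Traj S A n :=
  (fun i => ω.1 i.castSucc, fun i => ω.2 i.castSucc)

/-- The probability of a trajectory if `s_0 ∼ ρ`, `a_t ∼ π (s_t)` and `s_{t+1} ∼ P (s_t, a_t)`. -/
noncomputable def trajProb (M : MDP S A) (π : Policy S A) (ρ : stdSimplex ℝ S) {n : ℕ}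
    (ω : Traj S A n) : ℝ :=
  ρ (ω.1 0) * ∏ t : Fin n,
    (π (ω.1 t.castSucc) (ω.2 t) * M.P (ω.1 t.castSucc) (ω.2 t) (ω.1 t.succ))

theorem trajProb_nonneg (M : MDP S A) (π : Policy S A) (ρ : stdSimplex ℝ S) {n : ℕ}
    (ω : Traj S A n) : 0 ≤ trajProb M π ρ ω :=
  mul_nonneg (ρ.2.1 _) (Finset.prod_nonneg fun _ _ => mul_nonneg ((π _).2.1 _) ((M.P _ _).2.1 _))

theorem sum_trajProb (M : MDP S A) (π : Policy S A) (ρ : stdSimplex ℝ S) (n : ℕ) :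
    ∑ ω : Traj S A n, trajProb M π ρ ω = 1 := by
  induction n with
  | zero =>
    rw [Fintype.sum_prod_type]
    simp only [trajProb, Finset.univ_eq_empty, Finset.prod_empty, mul_one,
      Finset.sum_const, Finset.card_univ, Fintype.card_unique, one_smul]
    rw [← (Equiv.funUnique (Fin 1) S).symm.sum_comp]
    exact ρ.2.2
  | succ n ih =>
    rw [← ih, Fintype.sum_prod_type, Fintype.sum_prod_type,
      ← (Fin.snocEquiv fun _ : Fin (n + 1 + 1) => S).sum_comp, Fintype.sum_prod_type,
      Finset.sum_comm]
    refine Finset.sum_congr rfl fun s _ => ?_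
    rw [Finset.sum_comm, ← (Fin.snocEquiv fun _ : Fin (n + 1) => A).sum_comp,
      Fintype.sum_prod_type, Finset.sum_comm]
    refine Finset.sum_congr rfl fun a _ => ?_
    have key : ∀ (s' : S) (a' : A),
        trajProb M π ρ ((Fin.snocEquiv fun _ : Fin (n + 1 + 1) => S) (s', s),
          (Fin.snocEquiv fun _ : Fin (n + 1) => A) (a', a))
        = trajProb M π ρ (s, a) * (π (s (Fin.last n)) a' * M.P (s (Fin.last n)) a' s') := by
      intro s' a'
      have h0 : (Fin.snoc s s' : Fin (n + 1 + 1) → S) 0 = s 0 :=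
        Fin.snoc_castSucc (α := fun _ => S) s' s 0
      simp only [trajProb, Fin.snocEquiv_apply, Fin.prod_univ_castSucc, Fin.snoc_castSucc,
        Fin.snoc_last, Fin.succ_last, Fin.succ_castSucc, h0, mul_assoc]
    simp only [key]
    have hP : ∀ s₁ a', ∑ s', M.P s₁ a' s' = 1 := fun s₁ a' => (M.P s₁ a').2.2
    have hπ : ∀ s₁, ∑ a', π s₁ a' = 1 := fun s₁ => (π s₁).2.2
    simp only [← Finset.mul_sum, hP, hπ, mul_one]

/-- The law of the first `n` transitions as a probability vector on trajectories. -/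
noncomputable def trajLaw (M : MDP S A) (π : Policy S A) (ρ : stdSimplex ℝ S) (n : ℕ) :
    stdSimplex ℝ (Traj S A n) :=
  ⟨fun ω => trajProb M π ρ ω, fun ω => trajProb_nonneg M π ρ ω, sum_trajProb M π ρ n⟩

/-- The softmax policy of a table `Q`: `π s a ∝ exp (Q s a / lam)`. -/
noncomputable def softmaxPolicy [Nonempty A] (lam : ℝ) (Q : S → A → ℝ) : Policy S A := fun s =>
  ⟨fun a => Real.exp (Q s a / lam) / ∑ a', Real.exp (Q s a' / lam),
    fun a => div_nonneg (Real.exp_pos _).le (Finset.sum_nonneg fun _ _ => (Real.exp_pos _).le),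
    by
      rw [← Finset.sum_div]
      exact div_self (Finset.sum_pos (fun _ _ => Real.exp_pos _) Finset.univ_nonempty).ne'⟩

variable [DecidableEq S] [DecidableEq A]

/-- One soft Q-learning update with step size `α` after observing the transition `s, a, s'`. -/
noncomputable def softQStep (M : MDP S A) (γ lam α : ℝ) (Q : S → A → ℝ) (s : S) (a : A) (s' : S) :
    S → A → ℝ := fun s₁ a₁ =>
  if s₁ = s ∧ a₁ = a then
    Q s a + α * (M.r s a + γ * (lam * Real.log (∑ a', Real.exp (Q s' a' / lam))) - Q s a)
  else Q s₁ a₁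

/-- The table after the `n` iterations of soft Q-learning along a trajectory, started from `0`;
iteration `t` uses the step size `α t`. -/
noncomputable def softQ (M : MDP S A) (γ lam : ℝ) (α : ℕ → ℝ) :
    (n : ℕ) → Traj S A n → S → A → ℝ
  | 0, _ => fun _ _ => 0
  | n + 1, ω => softQStep M γ lam (α n) (softQ M γ lam α n ω.init)
      (ω.1 (Fin.last n).castSucc) (ω.2 (Fin.last n)) (ω.1 (Fin.last (n + 1)))

/-- The policy returned by soft Q-learning after `n` iterations. -/
noncomputable def softQPolicy [Nonempty A] (M : MDP S A) (γ lam : ℝ) (α : ℕ → ℝ) (n : ℕ)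
    (ω : Traj S A n) : Policy S A :=
  softmaxPolicy lam (softQ M γ lam α n ω)

/-- The step sizes `α_t = h / (t + t₀)`. -/
noncomputable def stepSize (h t₀ : ℝ) : ℕ → ℝ := fun t => h / (t + t₀)

end SoftQLearning

section Oracle

variable {S A : Type*} [Fintype S] [Fintype A]

/-- `E ‖π* - π^o‖²` for a random policy `π^o` on the finite probability space `(Ω, law)`. -/
noncomputable def meanSqError {Ω : Type*} [Fintype Ω] (πstar : Policy S A) (law : stdSimplex ℝ Ω)
    (πo : Ω → Policy S A) : ℝ :=
  ∑ ω, law ω * policyDist πstar (πo ω) ^ 2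

/-- The inexact-oracle condition with accuracy `δ`, for a family of problems indexed by the leader's
decision `x` and the context `ξ` with optimal policies `πstar x ξ`: the oracle's random policy
`πo x ξ` is at mean squared distance at most `δ ^ 2` from `πstar x ξ`, for all `x` and `ξ`. -/
def IsInexactOracle {X Ξ : Type*} (πstar : X → Ξ → Policy S A) {Ω : X → Ξ → Type*}
    [∀ x ξ, Fintype (Ω x ξ)] (law : ∀ x ξ, stdSimplex ℝ (Ω x ξ))
    (πo : ∀ x ξ, Ω x ξ → Policy S A) (δ : ℝ) : Prop :=
  ∀ x ξ, meanSqError (πstar x ξ) (law x ξ) (πo x ξ) ≤ δ ^ 2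

/-- Soft Q-learning with behavioural policy `πB` and step sizes `h / (t + t₀)` reaches every accuracy
`δ ∈ (0, 1)` within `C * log (1 / δ) / δ ^ 2` iterations and keeps it from then on, for every law
`ρ` of the first state. -/
def SoftQRate [DecidableEq S] [DecidableEq A] [Nonempty A] (M : MDP S A) (γ lam : ℝ)
    (πB πstar : Policy S A) (h t₀ C : ℝ) : Prop :=
  ∀ (ρ : stdSimplex ℝ S) (δ : ℝ), 0 < δ → δ < 1 →
    ∃ T : ℕ, (T : ℝ) ≤ C * (Real.log (1 / δ) / δ ^ 2) ∧
      ∀ n, T ≤ n → meanSqError πstar (trajLaw M πB ρ n)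
        (softQPolicy M γ lam (stepSize h t₀) n) ≤ δ ^ 2

end Oracle

set_option linter.unusedSectionVars false

/-! ### Elementary inequalities for powers -/

/-! Optimality. The soft Bellman operator is a `γ`-contraction in the sup norm; let `Q` be its fixed
point. Telescoping expresses the value of any policy as the soft maximum of `Q` minus the discounted
sum of one-step Gibbs gaps (`valueFn_eq`). The gaps are nonnegative and vanish exactly where the
policy is the softmax of `Q`, so the softmax is optimal. An optimal policy agrees with it at every
state it reaches, and irreducibility makes it reach all of them (`isUniqueOptimal_softmaxPolicy`).

Rate. The sup norm, in which the operator contracts, is replaced by the smooth potential `V = ∑ (Q -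
Qs) ^ (2 * j + 2)`. Updating a pair with error `x` changes `V` on average by at most `α * (γ ^ (2 *
j + 2) * V - x ^ (2 * j + 2))`, up to small terms. Over a block of `N` steps every pair is visited
at least `p` times on average, so the loss is about `p * α * V`, while the gain is of order `N * α *
γ ^ (2 * j + 2) * V`; for large `j` the loss wins (`blockOp_powPotential_le`). As the noise enters
at order `α ^ (j + 2)`, `exists_decay_of_block_recursion` yields `E V = O(t ^ (-(j + 1)))`, whence a
mean squared error of order `1 / t` for the table and, by Lipschitz continuity of the softmax, for
the policy.

All constants depend on the problem only through the reward bound, `N` and `p`. The latter two come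
from irreducibility, or uniformly from the stationary mass and the mixing time
(`exists_hasVisits_of_hasMixing`). -/

theorem succ_mul_pow_mul_le {x b : ℝ} (hx : 0 ≤ x) (hb : 0 ≤ b) (n : ℕ) :
    (n + 1) * x ^ n * b ≤ n * x ^ (n + 1) + b ^ (n + 1) := by
  rcases hx.eq_or_lt with rfl | hx
  · rcases n with _ | n
    · simp
    · simp only [ne_eq, Nat.add_eq_zero_iff, one_ne_zero, and_false, not_false_eq_true, zero_pow,
        mul_zero, zero_mul, zero_add]
      positivity
  -- Bernoulli's inequality for `b / x`, multiplied by `x ^ (n + 1)`.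
  · have h := one_add_mul_sub_le_pow (a := b / x) (by linarith [div_nonneg hb hx.le]) (n + 1)
    have h2 := mul_le_mul_of_nonneg_right h (pow_pos hx (n + 1)).le
    rw [← mul_pow, div_mul_cancel₀ _ hx.ne'] at h2
    have h3 : (1 + ((n + 1 : ℕ) : ℝ) * (b / x - 1)) * x ^ (n + 1)
        = (n + 1) * x ^ n * b - n * x ^ (n + 1) := by
      field_simp
      push_cast
      ring
    linarith

/-- The tangent inequality for the even power `2 * j + 2`. -/
theorem even_pow_tangent (j : ℕ) (x e b : ℝ) (he : |e| ≤ b) :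
    (2 * j + 2 : ℝ) * x ^ (2 * j + 1) * (e - x) ≤ b ^ (2 * j + 2) - x ^ (2 * j + 2) := by
  have h := succ_mul_pow_mul_le (abs_nonneg x) ((abs_nonneg e).trans he) (2 * j + 1)
  have hev : |x| ^ (2 * j + 1 + 1) = x ^ (2 * j + 2) := by
    rw [show 2 * j + 2 = 2 * (j + 1) by ring, pow_mul, pow_mul, sq_abs]
  rw [hev] at h
  have h1 : x ^ (2 * j + 1) * e ≤ |x| ^ (2 * j + 1) * b := by
    calc x ^ (2 * j + 1) * e ≤ |x ^ (2 * j + 1) * e| := le_abs_self _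
      _ = |x| ^ (2 * j + 1) * |e| := by rw [abs_mul, abs_pow]
      _ ≤ _ := by gcongr
  have h2 : (2 * j + 2 : ℝ) * (x ^ (2 * j + 1) * e) ≤ (2 * j + 2) * (|x| ^ (2 * j + 1) * b) := by
    gcongr
  push_cast at h
  have h3 : x ^ (2 * j + 2) = x ^ (2 * j + 1) * x := pow_succ _ _
  rw [h3] at h ⊢
  have h4 : b ^ (2 * j + 1 + 1) = b ^ (2 * j + 2) := rfl
  rw [h4] at h
  linarith

/-- Passing from one exponent to the next multiplies the Taylor remainder by `x + d` and adds `(n +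
2) * x ^ (n + 1) * d ^ 2`. The constant works because `(n + 2) ^ 2 + (n + 2) ≤ (n + 3) ^ 2`. -/
theorem abs_pow_sub_linear_le (x d : ℝ) (n : ℕ) :
    |(x + d) ^ (n + 2) - x ^ (n + 2) - (n + 2) * x ^ (n + 1) * d|
      ≤ (n + 2) ^ 2 * d ^ 2 * (|x| + |d|) ^ n := by
  induction n with
  | zero =>
    have : (x + d) ^ 2 - x ^ 2 - (((0 : ℕ) : ℝ) + 2) * x ^ 1 * d = d ^ 2 := by push_cast; ring
    simp only [zero_add] at this ⊢
    rw [this, abs_of_nonneg (sq_nonneg d)]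
    push_cast
    nlinarith [sq_nonneg d]
  | succ n ih =>
    have e : (x + d) ^ (n + 1 + 2) - x ^ (n + 1 + 2) - (((n + 1 : ℕ) : ℝ) + 2) * x ^ (n + 1 + 1) * d
        = (x + d) * ((x + d) ^ (n + 2) - x ^ (n + 2) - (n + 2) * x ^ (n + 1) * d)
          + (n + 2) * x ^ (n + 1) * d ^ 2 := by
      push_cast; ring
    rw [e]
    have hs : 0 ≤ |x| + |d| := by positivity
    have hx : |x| ≤ |x| + |d| := by linarith [abs_nonneg d]
    have h1 : |(x + d) * ((x + d) ^ (n + 2) - x ^ (n + 2) - (n + 2) * x ^ (n + 1) * d)|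
        ≤ (|x| + |d|) * ((n + 2) ^ 2 * d ^ 2 * (|x| + |d|) ^ n) := by
      rw [abs_mul]
      exact mul_le_mul (abs_add_le x d) ih (abs_nonneg _) hs
    have h2 : |((n : ℝ) + 2) * x ^ (n + 1) * d ^ 2| ≤ (n + 2) * (|x| + |d|) ^ (n + 1) * d ^ 2 := by
      rw [abs_mul, abs_mul, abs_pow, abs_of_nonneg (sq_nonneg d),
        abs_of_nonneg (by positivity : (0 : ℝ) ≤ n + 2)]
      gcongr
    refine (abs_add_le _ _).trans ((add_le_add h1 h2).trans ?_)
    have h3 : 0 ≤ d ^ 2 * (|x| + |d|) ^ (n + 1) := by positivity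
    have h4 : (|x| + |d|) ^ (n + 1) = (|x| + |d|) ^ n * (|x| + |d|) := pow_succ _ _
    push_cast
    have h5 : (0 : ℝ) ≤ (n + 3) * (d ^ 2 * (|x| + |d|) ^ (n + 1)) := by positivity
    rw [h4] at h5 ⊢
    nlinarith

/-- Second-order expansion of an even power, the remainder being absorbed into a small multiple of
the power itself and a term of order `α ^ (j + 2)`. -/
theorem exists_even_pow_add_le (j : ℕ) {W ε : ℝ} (hW : 0 < W) (hε : 0 < ε) :
    ∃ C : ℝ, 0 ≤ C ∧ ∀ x w α : ℝ, |w| ≤ W → 0 ≤ α → α ≤ 1 →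
      (x + α * w) ^ (2 * j + 2) ≤ x ^ (2 * j + 2) + (2 * j + 2) * x ^ (2 * j + 1) * (α * w)
        + ε * α * x ^ (2 * j + 2) + C * α ^ (j + 2) := by
  set c : ℝ := (2 * j + 2) ^ 2 with hc
  have hc0 : 0 < c := by positivity
  set η : ℝ := min 1 (ε / (c * 4 ^ j)) with hη
  have hη0 : 0 < η := lt_min one_pos (by positivity)
  have hη1 : η ≤ 1 := min_le_left _ _
  have hη2 : c * 4 ^ j * η ≤ ε := by
    have := min_le_right 1 (ε / (c * 4 ^ j))
    rw [← hη, le_div_iff₀ (by positivity)] at this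
    linarith
  refine ⟨c * W ^ 2 * (4 * W ^ 2 / η) ^ j, by positivity, fun x w α hw hα hα1 => ?_⟩
  have hrem := (abs_le.1 (abs_pow_sub_linear_le x (α * w) (2 * j))).2
  push_cast at hrem
  have hw2 : w ^ 2 ≤ W ^ 2 := by
    rw [← sq_abs w]; gcongr
  have hd2 : (α * w) ^ 2 ≤ α ^ 2 * W ^ 2 := by
    rw [mul_pow]; gcongr
  have hαα : α ^ 2 ≤ α := by nlinarith
  have hpw : (|x| + |α * w|) ^ (2 * j) ≤ (2 * (x ^ 2 + (α * w) ^ 2)) ^ j := by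
    rw [pow_mul]
    gcongr
    nlinarith [sq_abs x, sq_abs (α * w), sq_nonneg (|x| - |α * w|)]
  have hx0 : 0 ≤ x ^ (2 * j + 2) := by
    rw [show 2 * j + 2 = 2 * (j + 1) by ring, pow_mul]; positivity
  suffices hh : c * (α * w) ^ 2 * (|x| + |α * w|) ^ (2 * j)
      ≤ ε * α * x ^ (2 * j + 2) + c * W ^ 2 * (4 * W ^ 2 / η) ^ j * α ^ (j + 2) by linarith
  have hC : 0 ≤ c * W ^ 2 * (4 * W ^ 2 / η) ^ j * α ^ (j + 2) := by positivity
  -- If `x ^ 2` dominates `α * W ^ 2 / η`, the remainder is a small multiple of `α * x ^ (2 * j +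
  -- 2)`. Otherwise `x ^ 2 = O(α)` and the remainder is `O(α ^ 2 * α ^ j)`.
  rcases le_or_gt (α * W ^ 2) (η * x ^ 2) with h | h
  · have h1 : (α * w) ^ 2 ≤ α * (η * x ^ 2) := by nlinarith
    have h2 : (α * w) ^ 2 ≤ x ^ 2 := by nlinarith [sq_nonneg x, sq_nonneg W]
    calc c * (α * w) ^ 2 * (|x| + |α * w|) ^ (2 * j)
        ≤ c * (α * (η * x ^ 2)) * (4 * x ^ 2) ^ j := by
          refine mul_le_mul (by gcongr) (hpw.trans ?_) (by positivity) (by positivity)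
          exact pow_le_pow_left₀ (by positivity) (by linarith) _
      _ = (c * 4 ^ j * η) * (α * x ^ (2 * j + 2)) := by
          rw [mul_pow, pow_add, pow_mul]; ring
      _ ≤ ε * (α * x ^ (2 * j + 2)) := by gcongr
      _ ≤ _ := by linarith
  · have h1 : x ^ 2 ≤ α * W ^ 2 / η := by
      rw [le_div_iff₀ hη0]; linarith
    have h2 : (α * w) ^ 2 ≤ α * W ^ 2 / η := by
      rw [le_div_iff₀ hη0]
      nlinarith [sq_nonneg W, sq_nonneg (α * w)]
    calc c * (α * w) ^ 2 * (|x| + |α * w|) ^ (2 * j)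
        ≤ c * (α ^ 2 * W ^ 2) * ((4 * W ^ 2 / η) * α) ^ j := by
          refine mul_le_mul (by gcongr) (hpw.trans ?_) (by positivity) (by positivity)
          have : (4 * W ^ 2 / η) * α = 2 * (α * W ^ 2 / η + α * W ^ 2 / η) := by ring
          exact pow_le_pow_left₀ (by positivity) (by linarith) _
      _ = c * W ^ 2 * (4 * W ^ 2 / η) ^ j * α ^ (j + 2) := by
          rw [mul_pow]; ring
      _ ≤ _ := by
          have : 0 ≤ ε * α * x ^ (2 * j + 2) := by positivity
          linarith

/-- Needed to replace the errors of an updated table by those of the table at the start of a block.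
Either the increment is at most `η * |x|` and Bernoulli applies, or `|x| = O(α)` and the power
itself is negligible. -/
theorem exists_le_even_pow_add (j : ℕ) {W ε : ℝ} (hW : 0 < W) (hε : 0 < ε) :
    ∃ C : ℝ, 0 ≤ C ∧ ∀ x w α : ℝ, |w| ≤ W → 0 ≤ α → α ≤ 1 →
      (1 - ε) * x ^ (2 * j + 2) - C * α ^ (j + 1) ≤ (x + α * w) ^ (2 * j + 2) := by
  set η : ℝ := min 1 (ε / (2 * j + 2)) with hη
  have hη0 : 0 < η := lt_min one_pos (by positivity)
  have hη1 : η ≤ 1 := min_le_left _ _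
  have hη2 : (2 * j + 2) * η ≤ ε := by
    have := min_le_right 1 (ε / (2 * j + 2))
    rw [← hη, le_div_iff₀ (by positivity)] at this
    linarith
  refine ⟨(W / η) ^ (2 * j + 2), by positivity, fun x w α hw hα hα1 => ?_⟩
  have hev : ∀ y : ℝ, |y| ^ (2 * j + 2) = y ^ (2 * j + 2) := fun y => by
    rw [show 2 * j + 2 = 2 * (j + 1) by ring, pow_mul, pow_mul, sq_abs]
  have hx0 : ∀ y : ℝ, 0 ≤ y ^ (2 * j + 2) := fun y => by rw [← hev]; positivity
  have hC : 0 ≤ (W / η) ^ (2 * j + 2) * α ^ (j + 1) := by positivity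
  have hd : |α * w| ≤ α * W := by
    rw [abs_mul, abs_of_nonneg hα]; gcongr
  rcases le_or_gt (α * W) (η * |x|) with h | h
  · have h1 : (1 - η) * |x| ≤ |x + α * w| := by
      have := abs_sub_abs_le_abs_sub x (-(α * w))
      rw [abs_neg, sub_neg_eq_add] at this
      linarith
    have h2 : ((1 - η) * |x|) ^ (2 * j + 2) ≤ |x + α * w| ^ (2 * j + 2) :=
      pow_le_pow_left₀ (mul_nonneg (by linarith) (abs_nonneg _)) h1 _
    rw [mul_pow, hev, hev] at h2
    have h3 := one_add_mul_le_pow (a := -η) (by linarith) (2 * j + 2)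
    push_cast at h3
    have h4 : (1 - ε) ≤ (1 - η) ^ (2 * j + 2) := by
      rw [sub_eq_add_neg 1 η]; linarith
    have := mul_le_mul_of_nonneg_right h4 (hx0 x)
    linarith
  · have h1 : |x| ≤ (W / η) * α := by
      rw [div_mul_eq_mul_div, le_div_iff₀ hη0]; linarith
    have h2 : |x| ^ (2 * j + 2) ≤ ((W / η) * α) ^ (2 * j + 2) := by gcongr
    rw [mul_pow, hev] at h2
    have h3 : α ^ (2 * j + 2) ≤ α ^ (j + 1) := pow_le_pow_of_le_one hα hα1 (by lia)
    have h4 : (W / η) ^ (2 * j + 2) * α ^ (2 * j + 2) ≤ (W / η) ^ (2 * j + 2) * α ^ (j + 1) := by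
      gcongr
    have h5 : 0 ≤ ε * x ^ (2 * j + 2) := mul_nonneg hε.le (hx0 x)
    linarith [hx0 (x + α * w)]

/-- A recursion with step sizes `h / (t + t₀)` over blocks of length `N` decays like
`(t + t₀) ^ (-k)`, provided `h` is large enough. -/
theorem exists_decay_of_block_recursion (k N : ℕ) (hN : 0 < N) {c D h t₀ b : ℝ} (hD : 0 ≤ D)
    (hh : k * N + 1 ≤ c * h) (hh0 : 0 ≤ h) (ht₀ : 1 ≤ t₀) (hct : c * h ≤ t₀) (hb : 0 ≤ b) :
    ∃ K : ℝ, 0 ≤ K ∧ ∀ u : ℕ → ℝ, (∀ t, u t ≤ b) →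
      (∀ t : ℕ, u (t + N) ≤ (1 - c * (h / (t + t₀))) * u t + D * (h / (t + t₀)) ^ (k + 1)) →
      ∀ t : ℕ, u t * (t + t₀) ^ k ≤ K := by
  have hNt : 0 < (N : ℝ) + t₀ := by positivity
  -- The first summand covers the times before `N`; the second absorbs the noise in the induction
  -- step.
  refine ⟨b * (N + t₀) ^ k + D * h ^ (k + 1), by positivity, fun u hub hu t => ?_⟩
  set K : ℝ := b * (N + t₀) ^ k + D * h ^ (k + 1) with hK
  have hK1 : D * h ^ (k + 1) ≤ K := by
    have : 0 ≤ b * ((N : ℝ) + t₀) ^ k := by positivity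
    linarith
  have hK0 : 0 ≤ K := le_trans (by positivity) hK1
  induction t using Nat.strong_induction_on with
  | _ t ih =>
    rcases lt_or_ge t N with h1 | h1
    · have h2 : ((t : ℝ) + t₀) ^ k ≤ (N + t₀) ^ k := by
        gcongr
      have h3 : u t * ((t : ℝ) + t₀) ^ k ≤ b * ((t : ℝ) + t₀) ^ k := by
        gcongr
        exact hub t
      have h4 : b * ((t : ℝ) + t₀) ^ k ≤ b * (N + t₀) ^ k := by gcongr
      have h5 : 0 ≤ D * h ^ (k + 1) := by positivity
      linarith
    · obtain ⟨s, rfl⟩ := Nat.exists_eq_add_of_le' h1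
      have hs := ih s (by lia)
      set X : ℝ := (s : ℝ) + t₀ with hX
      have hX0 : 0 < X := by positivity
      have hXt : t₀ ≤ X := by rw [hX]; linarith [Nat.cast_nonneg (α := ℝ) s]
      have hcX : c * (h / X) ≤ 1 := by
        rw [mul_div_assoc', div_le_one hX0]; linarith
      have husX : u s ≤ K / X ^ k := by
        rw [le_div_iff₀ (by positivity)]; exact hs
      have h2 : u (s + N) ≤ (1 - c * (h / X)) * (K / X ^ k) + D * (h / X) ^ (k + 1) := by
        refine (hu s).trans ?_
        gcongr
      have h3 : (1 - c * (h / X)) * (K / X ^ k) + D * (h / X) ^ (k + 1)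
          = (K * (1 - c * h / X) + D * h ^ (k + 1) / X) / X ^ k := by
        rw [div_pow, pow_succ X]
        field_simp
      -- The surplus `c * h - k * N ≥ 1` pays for the noise, since `D * h ^ (k + 1) ≤ K`.
      have h4 : K * (1 - c * h / X) + D * h ^ (k + 1) / X ≤ K * (1 - k * N / X) := by
        have e : K * (1 - k * N / X) - (K * (1 - c * h / X) + D * h ^ (k + 1) / X)
            = (K * (c * h - k * N) - D * h ^ (k + 1)) / X := by
          field_simp
          ring
        have : 0 ≤ (K * (c * h - k * N) - D * h ^ (k + 1)) / X := by
          apply div_nonneg _ hX0.le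
          nlinarith
        linarith
      -- Bernoulli: the factor `1 - k * N / X` compensates the growth of the weight from `X ^ k` to
      -- `(X + N) ^ k`.
      have hpos : (0 : ℝ) < X + N := by positivity
      have h5 : (1 - k * N / X : ℝ) * (X + N) ^ k ≤ X ^ k := by
        have h6 := one_add_mul_le_pow (a := -(N / (X + N) : ℝ))
          (by
            have : (N / (X + N) : ℝ) ≤ 1 := by rw [div_le_one hpos]; linarith
            linarith) k
        have h7 : (1 + -(N / (X + N)) : ℝ) = X / (X + N) := by
          field_simp; ring
        rw [h7, div_pow, le_div_iff₀ (by positivity)] at h6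
        refine le_trans ?_ h6
        gcongr
        have : (N / (X + N) : ℝ) ≤ N / X := by gcongr; linarith [Nat.cast_nonneg (α := ℝ) N]
        have := mul_le_mul_of_nonneg_left this (Nat.cast_nonneg (α := ℝ) k)
        rw [mul_div_assoc]
        linarith
      have e : (((s + N : ℕ) : ℝ) + t₀) = X + N := by push_cast; rw [hX]; ring
      rw [e]
      calc u (s + N) * (X + N) ^ k ≤ (K * (1 - k * N / X) / X ^ k) * (X + N) ^ k := by
            gcongr
            refine h2.trans (h3.le.trans ?_)
            gcongr
        _ = K * ((1 - k * N / X) * (X + N) ^ k) / X ^ k := by ring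
        _ ≤ K * X ^ k / X ^ k := by gcongr
        _ = K := by field_simp

/-! ### The soft maximum and the soft Bellman operator -/

section SoftValue

variable {A : Type*} [Fintype A] [Nonempty A]

/-- The soft maximum `lam * log ∑ a, exp (q a / lam)`. -/
noncomputable def softValue (lam : ℝ) (q : A → ℝ) : ℝ :=
  lam * Real.log (∑ a, Real.exp (q a / lam))

theorem sum_exp_pos (lam : ℝ) (q : A → ℝ) : 0 < ∑ a, Real.exp (q a / lam) :=
  Finset.sum_pos (fun _ _ => Real.exp_pos _) Finset.univ_nonempty

theorem sum_exp_le {lam d : ℝ} (hlam : 0 < lam) {q q' : A → ℝ} (h : ∀ a, q a ≤ q' a + d) :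
    ∑ a, Real.exp (q a / lam) ≤ Real.exp (d / lam) * ∑ a, Real.exp (q' a / lam) := by
  rw [Finset.mul_sum]
  refine Finset.sum_le_sum fun a _ => ?_
  rw [← Real.exp_add, Real.exp_le_exp, ← add_div]
  have := h a
  gcongr
  linarith

/-- Monotonicity together with equivariance under adding constants; this makes the soft maximum
nonexpansive in the sup norm. -/
theorem softValue_le_add {lam d : ℝ} (hlam : 0 < lam) {q q' : A → ℝ} (h : ∀ a, q a ≤ q' a + d) :
    softValue lam q ≤ softValue lam q' + d := by
  have h1 := Real.log_le_log (sum_exp_pos lam q) (sum_exp_le hlam h)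
  rw [Real.log_mul (Real.exp_pos _).ne' (sum_exp_pos lam q').ne', Real.log_exp] at h1
  have h2 := mul_le_mul_of_nonneg_left h1 hlam.le
  rw [mul_add, mul_div_cancel₀ _ hlam.ne'] at h2
  unfold softValue
  linarith

theorem abs_softValue_sub_le {lam d : ℝ} (hlam : 0 < lam) {q q' : A → ℝ}
    (h : ∀ a, |q a - q' a| ≤ d) : |softValue lam q - softValue lam q'| ≤ d := by
  rw [abs_le]
  constructor
  · have := softValue_le_add hlam (q := q') (q' := q) (d := d)
      fun a => by have := (abs_le.1 (h a)).1; linarith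
    linarith
  · have := softValue_le_add hlam (q := q) (q' := q') (d := d)
      fun a => by have := (abs_le.1 (h a)).2; linarith
    linarith

theorem abs_softValue_le {lam d : ℝ} (hlam : 0 < lam) {q : A → ℝ} (h : ∀ a, |q a| ≤ d) :
    |softValue lam q| ≤ lam * Real.log (Fintype.card A) + d := by
  have h1 := abs_softValue_sub_le hlam (q := q) (q' := fun _ => 0) (d := d) (by simpa using h)
  have h2 : softValue lam (fun _ : A => (0 : ℝ)) = lam * Real.log (Fintype.card A) := by
    simp [softValue]
  have h3 : 0 ≤ lam * Real.log (Fintype.card A) :=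
    mul_nonneg hlam.le (Real.log_natCast_nonneg _)
  rw [h2] at h1
  rw [abs_le] at h1 ⊢
  constructor <;> linarith [h1.1, h1.2]

end SoftValue

/-! ### The softmax policy: Lipschitz dependence, lower bounds, variational principle. -/

section Softmax

variable {S A : Type*} [Fintype S] [Fintype A] [Nonempty A]

theorem softmaxPolicy_apply (lam : ℝ) (Q : S → A → ℝ) (s : S) (a : A) :
    softmaxPolicy lam Q s a = Real.exp (Q s a / lam) / ∑ a', Real.exp (Q s a' / lam) := rfl

theorem softmaxPolicy_pos (lam : ℝ) (Q : S → A → ℝ) (s : S) (a : A) :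
    0 < softmaxPolicy lam Q s a := by
  rw [softmaxPolicy_apply]
  exact div_pos (Real.exp_pos _) (sum_exp_pos _ _)

theorem policy_le_one (π : Policy S A) (s : S) (a : A) : π s a ≤ 1 := by
  have h : ∑ a', π s a' = 1 := (π s).2.2
  rw [← h]
  exact Finset.single_le_sum (f := fun a' => π s a') (fun a' _ => stdSimplex.zero_le (π s) a')
    (Finset.mem_univ a)

/-- Numerator and denominator each change by a factor of at most `exp (d / lam)`, so the probability
keeps at least the fraction `exp (-(2 * d / lam)) ≥ 1 - 2 * d / lam`. -/
theorem softmaxPolicy_sub_le {lam d : ℝ} (hlam : 0 < lam) {Q Q' : S → A → ℝ}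
    (h : ∀ s a, |Q s a - Q' s a| ≤ d) (s : S) (a : A) :
    softmaxPolicy lam Q s a - softmaxPolicy lam Q' s a ≤ 2 * d / lam := by
  have h1 : Real.exp (-(2 * d / lam)) * softmaxPolicy lam Q s a ≤ softmaxPolicy lam Q' s a := by
    rw [softmaxPolicy_apply, softmaxPolicy_apply, mul_div_assoc',
      div_le_div_iff₀ (sum_exp_pos _ _) (sum_exp_pos _ _)]
    have h2 := sum_exp_le hlam (q := Q' s) (q' := Q s) (d := d)
      fun a => by have := (abs_le.1 (h s a)).1; linarith
    have h3 : Real.exp (Q s a / lam) ≤ Real.exp (d / lam) * Real.exp (Q' s a / lam) := by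
      rw [← Real.exp_add, Real.exp_le_exp, ← add_div]
      have := (abs_le.1 (h s a)).2
      gcongr
      linarith
    have h4 : Real.exp (-(2 * d / lam)) * (Real.exp (d / lam) * Real.exp (d / lam)) = 1 := by
      rw [← Real.exp_add, ← Real.exp_add]
      convert Real.exp_zero using 2
      ring
    calc Real.exp (-(2 * d / lam)) * Real.exp (Q s a / lam) * ∑ a', Real.exp (Q' s a' / lam)
        ≤ Real.exp (-(2 * d / lam)) * (Real.exp (d / lam) * Real.exp (Q' s a / lam))
          * (Real.exp (d / lam) * ∑ a', Real.exp (Q s a' / lam)) := by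
          gcongr
      _ = (Real.exp (-(2 * d / lam)) * (Real.exp (d / lam) * Real.exp (d / lam)))
          * (Real.exp (Q' s a / lam) * ∑ a', Real.exp (Q s a' / lam)) := by ring
      _ = _ := by rw [h4, one_mul]
  have h5 := Real.add_one_le_exp (-(2 * d / lam))
  have h6 := (softmaxPolicy_pos lam Q s a).le
  have h7 := policy_le_one (softmaxPolicy lam Q) s a
  have hd : 0 ≤ 2 * d / lam := by
    have := (abs_nonneg _).trans (h s a)
    positivity
  nlinarith

theorem policyDist_softmaxPolicy_le {lam d : ℝ} (hlam : 0 < lam) {Q Q' : S → A → ℝ} (hd : 0 ≤ d)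
    (h : ∀ s a, |Q s a - Q' s a| ≤ d) :
    policyDist (softmaxPolicy lam Q) (softmaxPolicy lam Q') ≤ 2 * d / lam := by
  have h0 : 0 ≤ 2 * d / lam := by positivity
  unfold policyDist
  rw [pi_norm_le_iff_of_nonneg h0]
  intro s
  rw [pi_norm_le_iff_of_nonneg h0]
  intro a
  rw [Real.norm_eq_abs, abs_le]
  constructor
  · have := softmaxPolicy_sub_le hlam (Q := Q') (Q' := Q)
      (fun s a => by rw [abs_sub_comm]; exact h s a) s a
    linarith
  · exact softmaxPolicy_sub_le hlam h s a

theorem le_softmaxPolicy {lam B : ℝ} (hlam : 0 < lam) {Q : S → A → ℝ}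
    (h : ∀ s a, |Q s a| ≤ B) (s : S) (a : A) :
    Real.exp (-(2 * B / lam)) / Fintype.card A ≤ softmaxPolicy lam Q s a := by
  have hc : (0 : ℝ) < Fintype.card A := by exact_mod_cast Fintype.card_pos
  rw [softmaxPolicy_apply, div_le_div_iff₀ hc (sum_exp_pos _ _)]
  have h1 : ∑ a', Real.exp (Q s a' / lam) ≤ Fintype.card A * Real.exp (B / lam) := by
    have : ∀ a' ∈ Finset.univ, Real.exp (Q s a' / lam) ≤ Real.exp (B / lam) := fun a' _ => by
      have := (abs_le.1 (h s a')).2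
      gcongr
    simpa using Finset.sum_le_card_nsmul _ _ _ this
  have h2 : Real.exp (-(B / lam)) ≤ Real.exp (Q s a / lam) := by
    have := (abs_le.1 (h s a)).1
    rw [← neg_div]
    gcongr
  calc Real.exp (-(2 * B / lam)) * ∑ a', Real.exp (Q s a' / lam)
      ≤ Real.exp (-(2 * B / lam)) * (Fintype.card A * Real.exp (B / lam)) := by gcongr
    _ = Real.exp (-(B / lam)) * Fintype.card A := by
      rw [mul_comm (Fintype.card A : ℝ), ← mul_assoc, ← Real.exp_add]
      congr 2
      ring
    _ ≤ _ := by gcongr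

/-- All entries lie between a common positive floor and `1`. The resulting distance below `1` serves
accuracies `δ` close to `1`, where `log (1 / δ)` vanishes. -/
theorem policyDist_softmaxPolicy_le_of_bounded {lam B : ℝ} (hlam : 0 < lam) {Q Q' : S → A → ℝ}
    (h : ∀ s a, |Q s a| ≤ B) (h' : ∀ s a, |Q' s a| ≤ B) {q : ℝ} (hq : 0 ≤ q)
    (hqB : 1 - Real.exp (-(2 * B / lam)) / Fintype.card A ≤ q) :
    policyDist (softmaxPolicy lam Q) (softmaxPolicy lam Q') ≤ q := by
  unfold policyDist
  rw [pi_norm_le_iff_of_nonneg hq]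
  intro s
  rw [pi_norm_le_iff_of_nonneg hq]
  intro a
  rw [Real.norm_eq_abs, abs_le]
  have h1 := le_softmaxPolicy hlam h s a
  have h2 := le_softmaxPolicy hlam h' s a
  have h3 := policy_le_one (softmaxPolicy lam Q) s a
  have h4 := policy_le_one (softmaxPolicy lam Q') s a
  constructor <;> linarith

/-- The Gibbs variational principle. -/
theorem gibbs_le {lam : ℝ} (hlam : 0 < lam) (Q : S → A → ℝ) (π : Policy S A) (s : S) :
    ∑ a, π s a * Q s a + lam * entropy π s ≤ softValue lam (Q s) ∧
      (∑ a, π s a * Q s a + lam * entropy π s = softValue lam (Q s) ↔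
        π s = softmaxPolicy lam Q s) := by
  set σ := softmaxPolicy lam Q with hσ
  have hlog : ∀ a, Q s a = softValue lam (Q s) + lam * Real.log (σ s a) := fun a => by
    rw [hσ, softmaxPolicy_apply, Real.log_div (Real.exp_pos _).ne' (sum_exp_pos _ _).ne',
      Real.log_exp, softValue]
    field_simp
    ring
  have hπ : ∑ a, π s a = 1 := (π s).2.2
  have hσ1 : ∑ a, σ s a = 1 := (σ s).2.2
  have hσ0 : ∀ a, 0 < σ s a := softmaxPolicy_pos lam Q s
  -- The gap is `lam` times the Kullback-Leibler divergence of `π s` from the softmax. The terms `σ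
  -- s a - π s a` in `klFun` cancel in the sum and make each summand nonnegative.
  have key : softValue lam (Q s) - (∑ a, π s a * Q s a + lam * entropy π s)
      = lam * ∑ a, σ s a * InformationTheory.klFun (π s a / σ s a) := by
    have e : ∀ a, σ s a * InformationTheory.klFun (π s a / σ s a)
        = -(Real.negMulLog (π s a)) - π s a * Real.log (σ s a) + σ s a - π s a := fun a => by
      rcases (stdSimplex.zero_le (π s) a).eq_or_lt with h0 | h0
      · have h0 : π s a = 0 := h0.symm
        simp [InformationTheory.klFun, h0]
      · have h0 : π s a ≠ 0 := h0.ne'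
        rw [InformationTheory.klFun, Real.log_div h0 (hσ0 a).ne', Real.negMulLog]
        have := (hσ0 a).ne'
        field_simp
    simp only [e, Finset.sum_sub_distrib, Finset.sum_add_distrib, Finset.sum_neg_distrib, hπ, hσ1]
    have e2 : ∑ a, π s a * Q s a
        = softValue lam (Q s) + lam * ∑ a, π s a * Real.log (σ s a) := by
      rw [Finset.mul_sum]
      calc ∑ a, π s a * Q s a
          = ∑ a, (π s a * softValue lam (Q s) + lam * (π s a * Real.log (σ s a))) :=
            Finset.sum_congr rfl fun a _ => by rw [hlog a]; ring
        _ = _ := by rw [Finset.sum_add_distrib, ← Finset.sum_mul, hπ, one_mul]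
    rw [e2, entropy]
    ring
  have hkl : ∀ a ∈ Finset.univ, 0 ≤ σ s a * InformationTheory.klFun (π s a / σ s a) := fun a _ =>
    mul_nonneg (hσ0 a).le
      (InformationTheory.klFun_nonneg (div_nonneg (stdSimplex.zero_le (π s) a) (hσ0 a).le))
  refine ⟨?_, ?_⟩
  · have := mul_nonneg hlam.le (Finset.sum_nonneg hkl)
    linarith
  · constructor
    · intro h
      have h0 : ∑ a, σ s a * InformationTheory.klFun (π s a / σ s a) = 0 := by
        have : lam * ∑ a, σ s a * InformationTheory.klFun (π s a / σ s a) = 0 := by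
          rw [← key, h, sub_self]
        exact (mul_eq_zero.1 this).resolve_left hlam.ne'
      rw [Finset.sum_eq_zero_iff_of_nonneg hkl] at h0
      ext a
      have h1 := (mul_eq_zero.1 (h0 a (Finset.mem_univ a))).resolve_left (hσ0 a).ne'
      rw [InformationTheory.klFun_eq_zero_iff (div_nonneg (stdSimplex.zero_le (π s) a) (hσ0 a).le)] at h1
      exact (div_eq_one_iff_eq (hσ0 a).ne').1 h1
    · intro h
      have : lam * ∑ a, σ s a * InformationTheory.klFun (π s a / σ s a) = 0 := by
        rw [Finset.sum_eq_zero fun a _ => ?_, mul_zero]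
        rw [h, div_self (hσ0 a).ne', InformationTheory.klFun_one, mul_zero]
      linarith

end Softmax

/-! ### The soft Bellman operator: contraction, fixed point, a priori bound. -/

section Bellman

variable {S A : Type*} [Fintype S] [Fintype A] [Nonempty A]

/-- The soft Bellman optimality operator. -/
noncomputable def softBellman (M : MDP S A) (γ lam : ℝ) (Q : S → A → ℝ) : S → A → ℝ := fun s a =>
  M.r s a + γ * ∑ s', M.P s a s' * softValue lam (Q s')

theorem abs_sum_stdSimplex_mul_le {I : Type*} [Fintype I] (p : stdSimplex ℝ I) {f : I → ℝ} {d : ℝ}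
    (h : ∀ i, |f i| ≤ d) : |∑ i, p i * f i| ≤ d := by
  have hp : ∑ i, p i = 1 := p.2.2
  calc |∑ i, p i * f i| ≤ ∑ i, |p i * f i| := Finset.abs_sum_le_sum_abs _ _
    _ ≤ ∑ i, p i * d := Finset.sum_le_sum fun i _ => by
        rw [abs_mul, abs_of_nonneg (stdSimplex.zero_le p i)]
        exact mul_le_mul_of_nonneg_left (h i) (stdSimplex.zero_le p i)
    _ = d := by rw [← Finset.sum_mul, hp, one_mul]

theorem abs_softBellman_sub_le {M : MDP S A} {γ lam d : ℝ} (hγ : 0 ≤ γ) (hlam : 0 < lam)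
    {Q Q' : S → A → ℝ} (h : ∀ s a, |Q s a - Q' s a| ≤ d) (s : S) (a : A) :
    |softBellman M γ lam Q s a - softBellman M γ lam Q' s a| ≤ γ * d := by
  have e : softBellman M γ lam Q s a - softBellman M γ lam Q' s a
      = γ * ∑ s', M.P s a s' * (softValue lam (Q s') - softValue lam (Q' s')) := by
    simp only [softBellman, mul_sub, Finset.sum_sub_distrib]
    ring
  rw [e, abs_mul, abs_of_nonneg hγ]
  gcongr
  exact abs_sum_stdSimplex_mul_le _ fun s' => abs_softValue_sub_le hlam (h s')

theorem exists_softBellman_fixedPoint (M : MDP S A) {γ lam : ℝ} (hγ0 : 0 ≤ γ) (hγ1 : γ < 1)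
    (hlam : 0 < lam) : ∃ Q : S → A → ℝ, softBellman M γ lam Q = Q := by
  have hc : ContractingWith ⟨γ, hγ0⟩ (softBellman M γ lam) := by
    refine ⟨by exact_mod_cast hγ1, LipschitzWith.of_dist_le_mul fun Q Q' => ?_⟩
    have h0 : 0 ≤ γ * dist Q Q' := by positivity
    change _ ≤ γ * dist Q Q'
    rw [dist_pi_le_iff h0]
    intro s
    rw [dist_pi_le_iff h0]
    intro a
    rw [Real.dist_eq]
    refine abs_softBellman_sub_le hγ0 hlam (fun s a => ?_) s a
    rw [← Real.dist_eq]
    exact (dist_le_pi_dist (Q s) (Q' s) a).trans (dist_le_pi_dist Q Q' s)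
  exact ⟨_, hc.fixedPoint_isFixedPt⟩

/-- The a priori bound on the tables of soft Q-learning with rewards bounded by `R`. -/
noncomputable def tableBound (A : Type*) [Fintype A] (γ lam R : ℝ) : ℝ :=
  (R + γ * (lam * Real.log (Fintype.card A))) / (1 - γ)

theorem tableBound_nonneg {γ lam R : ℝ} (hγ0 : 0 ≤ γ) (hγ1 : γ < 1) (hlam : 0 < lam)
    (hR : 0 ≤ R) : 0 ≤ tableBound A γ lam R := by
  have := Real.log_natCast_nonneg (Fintype.card A)
  have : 0 < 1 - γ := by linarith
  unfold tableBound
  positivity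

/-- The bound is the fixed point of the one-step estimate, hence invariant under updates. -/
theorem tableBound_eq {γ lam R : ℝ} (hγ1 : γ < 1) :
    R + γ * (lam * Real.log (Fintype.card A) + tableBound A γ lam R) = tableBound A γ lam R := by
  have : 1 - γ ≠ 0 := by linarith
  unfold tableBound
  field_simp
  ring

theorem abs_le_tableBound_of_fixedPoint {M : MDP S A} {γ lam R : ℝ} (hγ0 : 0 ≤ γ) (hγ1 : γ < 1)
    (hlam : 0 < lam) (hR : 0 ≤ R) (hr : ∀ s a, |M.r s a| ≤ R) {Q : S → A → ℝ}
    (hQ : softBellman M γ lam Q = Q) (s : S) (a : A) : |Q s a| ≤ tableBound A γ lam R := by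
  have hle : ∀ s a, |Q s a| ≤ ‖Q‖ := fun s a => by
    rw [← Real.norm_eq_abs]
    exact (norm_le_pi_norm (Q s) a).trans (norm_le_pi_norm Q s)
  have hlog := Real.log_natCast_nonneg (Fintype.card A)
  have h0 : 0 ≤ R + γ * (lam * Real.log (Fintype.card A) + ‖Q‖) := by positivity
  have h1 : ‖Q‖ ≤ R + γ * (lam * Real.log (Fintype.card A) + ‖Q‖) := by
    rw [pi_norm_le_iff_of_nonneg h0]
    intro s
    rw [pi_norm_le_iff_of_nonneg h0]
    intro a
    rw [Real.norm_eq_abs, ← hQ, softBellman]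
    refine (abs_add_le _ _).trans (add_le_add (hr s a) ?_)
    rw [hQ, abs_mul, abs_of_nonneg hγ0]
    gcongr
    exact abs_sum_stdSimplex_mul_le _ fun s' => abs_softValue_le hlam (hle s')
  refine (hle s a).trans ?_
  rw [tableBound, le_div_iff₀ (by linarith)]
  linarith

end Bellman

/-! ### Optimality of the softmax policy -/

section Optimality

variable {S A : Type*} [Fintype S] [DecidableEq S] [Fintype A]

theorem stateMatrix_nonneg (M : MDP S A) (π : Policy S A) (s s' : S) : 0 ≤ stateMatrix M π s s' :=
  Finset.sum_nonneg fun a _ => mul_nonneg (stdSimplex.zero_le (π s) a) (stdSimplex.zero_le _ s')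

theorem stateMatrix_sum (M : MDP S A) (π : Policy S A) (s : S) : ∑ s', stateMatrix M π s s' = 1 := by
  simp only [stateMatrix]
  rw [Finset.sum_comm]
  simp only [← Finset.mul_sum, stdSimplex.sum_eq_one, mul_one]

theorem matrix_pow_nonneg {I : Type*} [Fintype I] [DecidableEq I] {K : Matrix I I ℝ}
    (hK : ∀ i j, 0 ≤ K i j) (n : ℕ) (i j : I) : 0 ≤ (K ^ n) i j := by
  induction n generalizing i j with
  | zero =>
    rw [pow_zero, Matrix.one_apply]
    split_ifs <;> norm_num
  | succ n ih =>
    rw [pow_succ, Matrix.mul_apply]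
    exact Finset.sum_nonneg fun l _ => mul_nonneg (ih _ _) (hK _ _)

theorem matrix_pow_sum_eq_one {I : Type*} [Fintype I] [DecidableEq I] {K : Matrix I I ℝ}
    (hK : ∀ i, ∑ j, K i j = 1) (n : ℕ) (i : I) : ∑ j, (K ^ n) i j = 1 := by
  induction n generalizing i with
  | zero => simp [Matrix.one_apply]
  | succ n ih =>
    simp only [pow_succ, Matrix.mul_apply]
    rw [Finset.sum_comm]
    simp only [← Finset.mul_sum, hK, mul_one, ih]

theorem summable_discounted {K : Matrix S S ℝ} (hK : ∀ i j, 0 ≤ K i j) (hK1 : ∀ i, ∑ j, K i j = 1)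
    {γ : ℝ} (hγ0 : 0 ≤ γ) (hγ1 : γ < 1) (f : S → ℝ) (s : S) :
    Summable fun t : ℕ => γ ^ t * ∑ s', (K ^ t) s s' * f s' := by
  refine Summable.of_norm_bounded (g := fun t : ℕ => γ ^ t * ‖f‖)
    ((summable_geometric_of_lt_one hγ0 hγ1).mul_right _) fun t => ?_
  rw [norm_mul, norm_pow, Real.norm_of_nonneg hγ0]
  gcongr
  calc ‖∑ s', (K ^ t) s s' * f s'‖ ≤ ∑ s', ‖(K ^ t) s s' * f s'‖ := norm_sum_le _ _
    _ ≤ ∑ s', (K ^ t) s s' * ‖f‖ := Finset.sum_le_sum fun s' _ => by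
        rw [norm_mul, Real.norm_of_nonneg (matrix_pow_nonneg hK t s s')]
        exact mul_le_mul_of_nonneg_left (norm_le_pi_norm f s') (matrix_pow_nonneg hK t s s')
    _ = ‖f‖ := by rw [← Finset.sum_mul, matrix_pow_sum_eq_one hK1, one_mul]

/-- If `c = V - γ K V - g` then the discounted sum of `c` is `V` minus the discounted sum of
`g`. -/
theorem tsum_discounted_eq {K : Matrix S S ℝ} (hK : ∀ i j, 0 ≤ K i j)
    (hK1 : ∀ i, ∑ j, K i j = 1) {γ : ℝ} (hγ0 : 0 ≤ γ) (hγ1 : γ < 1) {c V g : S → ℝ}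
    (h : ∀ s, c s = V s - γ * ∑ s', K s s' * V s' - g s) (s : S) :
    ∑' t : ℕ, γ ^ t * ∑ s', (K ^ t) s s' * c s'
      = V s - ∑' t : ℕ, γ ^ t * ∑ s', (K ^ t) s s' * g s' := by
  have hV := summable_discounted hK hK1 hγ0 hγ1 V s
  have hg := summable_discounted hK hK1 hγ0 hγ1 g s
  have hV' := (summable_nat_add_iff 1).2 hV
  -- The `V` terms at times `t` and `t + 1` telescope in the sum.
  have e : ∀ t : ℕ, γ ^ t * ∑ s', (K ^ t) s s' * c s'
      = γ ^ t * ∑ s', (K ^ t) s s' * V s' - γ ^ (t + 1) * ∑ s', (K ^ (t + 1)) s s' * V s'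
        - γ ^ t * ∑ s', (K ^ t) s s' * g s' := fun t => by
    have e1 : ∑ s', (K ^ (t + 1)) s s' * V s' = ∑ u, (K ^ t) s u * ∑ s', K u s' * V s' := by
      simp only [pow_succ, Matrix.mul_apply, Finset.sum_mul, Finset.mul_sum]
      rw [Finset.sum_comm]
      exact Finset.sum_congr rfl fun _ _ => Finset.sum_congr rfl fun _ _ => by ring
    have e2 : ∑ s', (K ^ t) s s' * c s' = ∑ s', (K ^ t) s s' * V s'
        - γ * ∑ u, (K ^ t) s u * ∑ s', K u s' * V s' - ∑ s', (K ^ t) s s' * g s' := by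
      rw [Finset.mul_sum, ← Finset.sum_sub_distrib, ← Finset.sum_sub_distrib]
      exact Finset.sum_congr rfl fun u _ => by rw [h u]; ring
    rw [e1, e2, pow_succ]
    ring
  simp only [e]
  rw [(hV.sub hV').tsum_sub hg, hV.tsum_sub hV', hV.tsum_eq_zero_add]
  simp [Matrix.one_apply]

variable [Nonempty A]

/-- The loss of the policy `π` in one step, against the soft maximum of the table `Q`. -/
noncomputable def gibbsGap (lam : ℝ) (Q : S → A → ℝ) (π : Policy S A) (s : S) : ℝ :=
  softValue lam (Q s) - (∑ a, π s a * Q s a + lam * entropy π s)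

theorem gibbsGap_nonneg {lam : ℝ} (hlam : 0 < lam) (Q : S → A → ℝ) (π : Policy S A) (s : S) :
    0 ≤ gibbsGap lam Q π s := sub_nonneg.2 (gibbs_le hlam Q π s).1

theorem gibbsGap_eq_zero_iff {lam : ℝ} (hlam : 0 < lam) (Q : S → A → ℝ) (π : Policy S A) (s : S) :
    gibbsGap lam Q π s = 0 ↔ π s = softmaxPolicy lam Q s := by
  rw [← (gibbs_le hlam Q π s).2, gibbsGap, sub_eq_zero, eq_comm]

/-- Performance difference identity: since `Q` is a fixed point, the regularized reward equals the
soft value, minus its discounted mean after one step, minus the Gibbs gap. -/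
theorem valueFn_eq {M : MDP S A} {γ lam : ℝ} (hγ0 : 0 ≤ γ) (hγ1 : γ < 1) {Q : S → A → ℝ}
    (hQ : softBellman M γ lam Q = Q) (π : Policy S A) (s : S) :
    valueFn M γ lam π s = softValue lam (Q s)
      - ∑' t : ℕ, γ ^ t * ∑ s', (stateMatrix M π ^ t) s s' * gibbsGap lam Q π s' := by
  refine tsum_discounted_eq (V := fun s => softValue lam (Q s)) (stateMatrix_nonneg M π)
    (stateMatrix_sum M π) hγ0 hγ1 (fun s => ?_) s
  have e : ∑ a, π s a * Q s a = ∑ a, π s a * M.r s a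
      + γ * ∑ s', stateMatrix M π s s' * softValue lam (Q s') := by
    conv_lhs => rw [← hQ]
    simp only [softBellman, mul_add, Finset.sum_add_distrib, stateMatrix, Finset.sum_mul,
      Finset.mul_sum]
    congr 1
    rw [Finset.sum_comm]
    exact Finset.sum_congr rfl fun _ _ => Finset.sum_congr rfl fun _ _ => by ring
  rw [gibbsGap, e]
  ring

theorem objective_eq {M : MDP S A} {γ lam : ℝ} (hγ0 : 0 ≤ γ) (hγ1 : γ < 1) {Q : S → A → ℝ}
    (hQ : softBellman M γ lam Q = Q) (π : Policy S A) :
    objective M γ lam π = ∑ s, M.μ s * softValue lam (Q s)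
      - ∑ s, M.μ s * ∑' t : ℕ, γ ^ t * ∑ s', (stateMatrix M π ^ t) s s' * gibbsGap lam Q π s' := by
  simp only [objective, valueFn_eq hγ0 hγ1 hQ, mul_sub, Finset.sum_sub_distrib]

theorem pairMatrix_nonneg (M : MDP S A) (π : Policy S A) (i j : S × A) :
    0 ≤ pairMatrix M π i j :=
  mul_nonneg (stdSimplex.zero_le _ _) (stdSimplex.zero_le (π j.1) _)

theorem pairMatrix_sum (M : MDP S A) (π : Policy S A) (i : S × A) :
    ∑ j, pairMatrix M π i j = 1 := by
  rw [Fintype.sum_prod_type]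
  simp only [pairMatrix, ← Finset.mul_sum, stdSimplex.sum_eq_one, mul_one]

variable [DecidableEq A]

/-- A maximizer has no loss along its own trajectories, so it is the softmax wherever it goes. The
softmax plays every action, so any transition possible under `πB` is then possible under the
maximizer too, and irreducibility spreads the agreement to all states. -/
theorem isUniqueOptimal_softmaxPolicy {M : MDP S A} {γ lam : ℝ} (hγ0 : 0 < γ) (hγ1 : γ < 1)
    (hlam : 0 < lam) {Q : S → A → ℝ} (hQ : softBellman M γ lam Q = Q) {πB : Policy S A}
    (hirr : (pairMatrix M πB).IsIrreducible) :
    IsUniqueOptimal M γ lam (softmaxPolicy lam Q) := by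
  have hterm : ∀ (π : Policy S A) (s : S) (t : ℕ),
      0 ≤ γ ^ t * ∑ s', (stateMatrix M π ^ t) s s' * gibbsGap lam Q π s' := fun π s t =>
    mul_nonneg (pow_nonneg hγ0.le t) (Finset.sum_nonneg fun s' _ =>
      mul_nonneg (matrix_pow_nonneg (stateMatrix_nonneg M π) t s s') (gibbsGap_nonneg hlam Q π s'))
  have hloss : ∀ π : Policy S A, ∀ s ∈ Finset.univ, 0 ≤ M.μ s *
      ∑' t : ℕ, γ ^ t * ∑ s', (stateMatrix M π ^ t) s s' * gibbsGap lam Q π s' := fun π s _ =>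
    mul_nonneg (stdSimplex.zero_le _ _) (tsum_nonneg (hterm π s))
  have hopt : objective M γ lam (softmaxPolicy lam Q) = ∑ s, M.μ s * softValue lam (Q s) := by
    rw [objective_eq hγ0.le hγ1 hQ]
    have : ∀ s, gibbsGap lam Q (softmaxPolicy lam Q) s = 0 := fun s =>
      (gibbsGap_eq_zero_iff hlam Q _ s).2 rfl
    simp [this]
  refine ⟨fun π' => ?_, fun π' hπ' => ?_⟩
  · rw [hopt, objective_eq hγ0.le hγ1 hQ]
    linarith [Finset.sum_nonneg (hloss π')]
  · have h1 := hπ' (softmaxPolicy lam Q)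
    rw [hopt, objective_eq hγ0.le hγ1 hQ] at h1
    have h2 : ∑ s, M.μ s *
        ∑' t : ℕ, γ ^ t * ∑ s', (stateMatrix M π' ^ t) s s' * gibbsGap lam Q π' s' = 0 :=
      le_antisymm (by linarith) (Finset.sum_nonneg (hloss π'))
    rw [Finset.sum_eq_zero_iff_of_nonneg (hloss π')] at h2
    obtain ⟨s₀, hs₀⟩ : ∃ s₀, 0 < M.μ s₀ := by
      by_contra! h
      have := Finset.sum_nonpos fun s (_ : s ∈ Finset.univ) => h s
      rw [stdSimplex.sum_eq_one] at this
      linarith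
    have h3 : ∑' t : ℕ, γ ^ t * ∑ s', (stateMatrix M π' ^ t) s₀ s' * gibbsGap lam Q π' s' = 0 :=
      (mul_eq_zero.1 (h2 s₀ (Finset.mem_univ _))).resolve_left hs₀.ne'
    have hsum := summable_discounted (stateMatrix_nonneg M π') (stateMatrix_sum M π') hγ0.le hγ1
      (gibbsGap lam Q π') s₀
    have hreach : ∀ (t : ℕ) (s : S), 0 < (stateMatrix M π' ^ t) s₀ s →
        π' s = softmaxPolicy lam Q s := fun t s hts => by
      have h4 : γ ^ t * ∑ s', (stateMatrix M π' ^ t) s₀ s' * gibbsGap lam Q π' s' = 0 :=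
        le_antisymm (h3 ▸ hsum.le_tsum t fun j _ => hterm π' s₀ j) (hterm π' s₀ t)
      have h5 := (mul_eq_zero.1 h4).resolve_left (pow_pos hγ0 t).ne'
      rw [Finset.sum_eq_zero_iff_of_nonneg fun s' _ => mul_nonneg
        (matrix_pow_nonneg (stateMatrix_nonneg M π') t s₀ s') (gibbsGap_nonneg hlam Q π' s')] at h5
      exact (gibbsGap_eq_zero_iff hlam Q π' s).1
        ((mul_eq_zero.1 (h5 s (Finset.mem_univ s))).resolve_left hts.ne')
    -- Induction along a path of the behavioural chain. At each reached state `hreach` gives full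
    -- support, so the next state is reached as well.
    have hchain : ∀ (n : ℕ) (i j : S × A), (∃ t, 0 < (stateMatrix M π' ^ t) s₀ i.1) →
        0 < (pairMatrix M πB ^ n) i j → ∃ t, 0 < (stateMatrix M π' ^ t) s₀ j.1 := by
      intro n
      induction n with
      | zero =>
        intro i j hi hij
        rw [pow_zero, Matrix.one_apply] at hij
        split_ifs at hij with h
        · exact h ▸ hi
        · exact absurd hij (lt_irrefl _)
      | succ n ih =>
        intro i j hi hij
        rw [pow_succ, Matrix.mul_apply] at hij
        obtain ⟨l, -, hl⟩ := Finset.exists_lt_of_sum_lt (s := Finset.univ) (f := fun _ => (0 : ℝ))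
          (by simpa using hij)
        have hn := matrix_pow_nonneg (pairMatrix_nonneg M πB) n i l
        have hl1 : 0 < (pairMatrix M πB ^ n) i l :=
          hn.lt_of_ne fun h => by rw [← h, zero_mul] at hl; exact lt_irrefl _ hl
        have hl2 : 0 < pairMatrix M πB l j := pos_of_mul_pos_right hl hn
        obtain ⟨t, ht⟩ := ih i l hi hl1
        refine ⟨t + 1, ?_⟩
        rw [pow_succ, Matrix.mul_apply]
        refine (mul_pos ht ?_).trans_le (Finset.single_le_sum
          (f := fun u => (stateMatrix M π' ^ t) s₀ u * stateMatrix M π' u j.1) (fun u _ =>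
          mul_nonneg (matrix_pow_nonneg (stateMatrix_nonneg M π') t s₀ u)
            (stateMatrix_nonneg M π' u j.1)) (Finset.mem_univ l.1))
        have hP : 0 < M.P l.1 l.2 j.1 := (stdSimplex.zero_le _ _).lt_of_ne fun h => by
          rw [pairMatrix, ← h, zero_mul] at hl2; exact lt_irrefl _ hl2
        have hπ : 0 < π' l.1 l.2 := by
          rw [hreach t l.1 ht]; exact softmaxPolicy_pos lam Q _ _
        exact (mul_pos hπ hP).trans_le (Finset.single_le_sum
          (f := fun a => π' l.1 a * M.P l.1 a j.1) (fun a _ =>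
          mul_nonneg (stdSimplex.zero_le (π' l.1) a) (stdSimplex.zero_le _ _)) (Finset.mem_univ l.2))
    funext s
    obtain ⟨a⟩ := ‹Nonempty A›
    obtain ⟨n, -, hn⟩ := (Matrix.isIrreducible_iff_exists_pow_pos (pairMatrix_nonneg M πB)).1 hirr
      (s₀, a) (s, a)
    obtain ⟨t, ht⟩ := hchain n (s₀, a) (s, a) ⟨0, by simp⟩ hn
    exact hreach t s ht

end Optimality

/-! ### Expected numbers of visits of a finite chain -/

section Visits

variable {I : Type*} [Fintype I] [DecidableEq I]

/-- From every starting point, every state is visited at least `p` times on average during the first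
`N` steps. -/
def HasVisits (K : Matrix I I ℝ) (N : ℕ) (p : ℝ) : Prop :=
  ∀ i j, p ≤ (∑ l ∈ Finset.range N, K ^ l) i j

theorem HasVisits.of_le_pow {K : Matrix I I ℝ} (hK : ∀ i j, 0 ≤ K i j) {N : ℕ} {p : ℝ}
    (h : ∀ i j, ∃ n < N, p ≤ (K ^ n) i j) : HasVisits K N p := fun i j => by
  obtain ⟨n, hn, hp⟩ := h i j
  rw [Matrix.sum_apply]
  exact hp.trans (Finset.single_le_sum (f := fun l => (K ^ l) i j)
    (fun l _ => matrix_pow_nonneg hK l i j) (Finset.mem_range.2 hn))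

/-- There are finitely many pairs, so the travel times have a common bound and the corresponding
positive powers a common positive minimum. -/
theorem exists_hasVisits_of_isIrreducible {K : Matrix I I ℝ} (hK : K.IsIrreducible) :
    ∃ (N : ℕ) (p : ℝ), 0 < N ∧ 0 < p ∧ HasVisits K N p := by
  have h := (Matrix.isIrreducible_iff_exists_pow_pos hK.nonneg).1 hK
  choose n _ hn using h
  obtain ⟨N, hN⟩ := (Set.finite_range fun q : I × I => n q.1 q.2).bddAbove
  have hp : ∃ p : ℝ, 0 < p ∧ ∀ q : I × I, p ≤ (K ^ n q.1 q.2) q.1 q.2 := by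
    rcases isEmpty_or_nonempty (I × I) with _ | _
    · exact ⟨1, one_pos, fun q => isEmptyElim q⟩
    · obtain ⟨q, hq⟩ := Finite.exists_min fun q : I × I => (K ^ n q.1 q.2) q.1 q.2
      exact ⟨_, hn q.1 q.2, hq⟩
  obtain ⟨p, hp0, hp⟩ := hp
  exact ⟨N + 1, p, N.succ_pos, hp0, .of_le_pow hK.nonneg fun i j =>
    ⟨n i j, Nat.lt_succ_of_le (hN ⟨(i, j), rfl⟩), hp (i, j)⟩⟩

/-- A kernel any two rows of which are at `ℓ¹` distance at most `1` halves the oscillation of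
functions. -/
theorem oscillation_mul_le_half {L : Matrix I I ℝ} (hL1 : ∀ i, ∑ j, L i j = 1)
    (hL : ∀ i i', ∑ j, |L i j - L i' j| ≤ 1) {f : I → ℝ} {c : ℝ} (hf : ∀ i i', f i - f i' ≤ c)
    (i i' : I) : ∑ j, L i j * f j - ∑ j, L i' j * f j ≤ c / 2 := by
  have : Nonempty I := ⟨i⟩
  obtain ⟨i₀, hi₀⟩ := Finite.exists_min f
  -- Both rows have mass one, so `f` may be centred at the midpoint of its range, leaving values of
  -- size at most `c / 2`.
  have e : ∑ j, L i j * f j - ∑ j, L i' j * f j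
      = ∑ j, (L i j - L i' j) * (f j - f i₀ - c / 2) := by
    have : ∀ j, (L i j - L i' j) * (f j - f i₀ - c / 2)
        = (L i j * f j - L i' j * f j) - (L i j * (f i₀ + c / 2) - L i' j * (f i₀ + c / 2)) :=
      fun j => by ring
    simp only [this, Finset.sum_sub_distrib, ← Finset.sum_mul, hL1]
    ring
  have hc : 0 ≤ c := by simpa using hf i i
  rw [e]
  calc ∑ j, (L i j - L i' j) * (f j - f i₀ - c / 2) ≤ ∑ j, |L i j - L i' j| * (c / 2) :=
        Finset.sum_le_sum fun j _ => by
          refine (le_abs_self _).trans ?_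
          rw [abs_mul]
          gcongr
          rw [abs_le]
          constructor <;> linarith [hi₀ j, hf j i₀]
    _ = (∑ j, |L i j - L i' j|) * (c / 2) := by rw [Finset.sum_mul]
    _ ≤ 1 * (c / 2) := by gcongr; exact hL i i'
    _ = c / 2 := one_mul _

/-- Rows of `K ^ τ` are within `ℓ¹` distance `1 / 2` of `ν`, hence within `1` of each other, so each
`τ` steps halve the oscillation of the columns. After `τ * q` steps it is below `m / 2`, while the
`ν`-average of column `j` is `ν j ≥ m`. -/
theorem exists_hasVisits_of_hasMixing (I : Type*) [Fintype I] [DecidableEq I] {m : ℝ} (hm : 0 < m)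
    (τ : ℕ) : ∃ N : ℕ, 0 < N ∧ ∀ K : Matrix I I ℝ, (∀ i j, 0 ≤ K i j) → (∀ i, ∑ j, K i j = 1) →
      HasMixing K m τ → HasVisits K N (m / 2) := by
  obtain ⟨q, hq⟩ := exists_pow_lt_of_lt_one (half_pos hm) (by norm_num : (1 / 2 : ℝ) < 1)
  refine ⟨τ * q + 1, Nat.succ_pos _, fun K hK hK1 ⟨ν, hν, hνm, hmix⟩ => .of_le_pow hK
    fun i j => ⟨τ * q, Nat.lt_succ_self _, ?_⟩⟩
  have hrow : ∀ i i', ∑ j, |(K ^ τ) i j - (K ^ τ) i' j| ≤ 1 := fun i i' => by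
    have h : ∀ j, |(K ^ τ) i j - (K ^ τ) i' j| ≤ |(K ^ τ) i j - ν j| + |(K ^ τ) i' j - ν j| :=
      fun j => by
        rw [abs_sub_comm ((K ^ τ) i' j)]
        exact abs_sub_le _ _ _
    have := Finset.sum_le_sum fun j (_ : j ∈ Finset.univ) => h j
    rw [Finset.sum_add_distrib] at this
    linarith [hmix i, hmix i']
  have hosc : ∀ (q : ℕ) (i i' : I), (K ^ (τ * q)) i j - (K ^ (τ * q)) i' j ≤ (1 / 2 : ℝ) ^ q := by
    intro q
    induction q with
    | zero =>
      intro i i'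
      rw [mul_zero, pow_zero, pow_zero, Matrix.one_apply, Matrix.one_apply]
      split_ifs <;> norm_num
    | succ q ih =>
      intro i i'
      have := oscillation_mul_le_half (matrix_pow_sum_eq_one hK1 τ) hrow ih i i'
      rw [mul_add, mul_one, add_comm, pow_add K, Matrix.mul_apply, Matrix.mul_apply]
      rw [pow_succ]
      linarith
  have hstat : ∀ n : ℕ, ∑ l, ν l * (K ^ n) l j = ν j := fun n => by
    induction n with
    | zero => simp [Matrix.one_apply]
    | succ n ih =>
      have e : ∑ l, ν l * (K ^ (n + 1)) l j = ∑ u, (∑ l, ν l * K l u) * (K ^ n) u j := by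
        simp only [pow_succ', Matrix.mul_apply, Finset.sum_mul, Finset.mul_sum]
        rw [Finset.sum_comm]
        exact Finset.sum_congr rfl fun _ _ => Finset.sum_congr rfl fun _ _ => by ring
      rw [e]
      simp only [hν, ih]
  have h1 : ν j ≤ ∑ l, ν l * ((K ^ (τ * q)) i j + (1 / 2 : ℝ) ^ q) := by
    rw [← hstat (τ * q)]
    refine Finset.sum_le_sum fun l _ => mul_le_mul_of_nonneg_left ?_ (stdSimplex.zero_le ν l)
    linarith [hosc q l i]
  rw [← Finset.sum_mul, stdSimplex.sum_eq_one, one_mul] at h1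
  linarith [hνm j]

end Visits

/-! ### Visit counts of the pair chain started from a state. -/

section ExpectedVisits

variable {S A : Type*} [Fintype S] [DecidableEq S] [Fintype A] [DecidableEq A] [Nonempty A]

/-- The expected number of visits of the pair chain to `j` during `n` steps from the state `s`. -/
noncomputable def expVisits (M : MDP S A) (π : Policy S A) (n : ℕ) (s : S) (j : S × A) : ℝ :=
  ∑ a, π s a * (∑ l ∈ Finset.range n, pairMatrix M π ^ l) (s, a) j

/-- First-step decomposition; it matches the recursion that defines `blockOp`. -/
theorem sum_pow_pairMatrix_succ (M : MDP S A) (π : Policy S A) (n : ℕ) (s : S) (a : A)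
    (j : S × A) : (∑ l ∈ Finset.range (n + 1), pairMatrix M π ^ l) (s, a) j
      = (if (s, a) = j then 1 else 0) + ∑ s', M.P s a s' * expVisits M π n s' j := by
  have e : ∑ l ∈ Finset.range (n + 1), pairMatrix M π ^ l
      = 1 + pairMatrix M π * ∑ l ∈ Finset.range n, pairMatrix M π ^ l := by
    rw [Finset.sum_range_succ', pow_zero, add_comm, Finset.mul_sum]
    simp only [pow_succ']
  rw [e, Matrix.add_apply, Matrix.one_apply, Matrix.mul_apply, Fintype.sum_prod_type]
  simp only [expVisits, pairMatrix, Finset.mul_sum, mul_assoc]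

theorem expVisits_nonneg (M : MDP S A) (π : Policy S A) (n : ℕ) (s : S) (j : S × A) :
    0 ≤ expVisits M π n s j := by
  refine Finset.sum_nonneg fun a _ => mul_nonneg (stdSimplex.zero_le (π s) a) ?_
  rw [Matrix.sum_apply]
  exact Finset.sum_nonneg fun l _ => matrix_pow_nonneg (pairMatrix_nonneg M π) l _ _

theorem expVisits_le (M : MDP S A) (π : Policy S A) (n : ℕ) (s : S) (j : S × A) :
    expVisits M π n s j ≤ n := by
  have h : ∀ a, (∑ l ∈ Finset.range n, pairMatrix M π ^ l) (s, a) j ≤ n := fun a => by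
    rw [Matrix.sum_apply]
    have : ∀ l ∈ Finset.range n, (pairMatrix M π ^ l) (s, a) j ≤ 1 := fun l _ => by
      rw [← matrix_pow_sum_eq_one (pairMatrix_sum M π) l (s, a)]
      exact Finset.single_le_sum (f := fun j => (pairMatrix M π ^ l) (s, a) j)
        (fun j _ => matrix_pow_nonneg (pairMatrix_nonneg M π) l _ _) (Finset.mem_univ j)
    simpa using Finset.sum_le_card_nsmul _ _ _ this
  calc expVisits M π n s j ≤ ∑ a, π s a * n := Finset.sum_le_sum fun a _ =>
        mul_le_mul_of_nonneg_left (h a) (stdSimplex.zero_le (π s) a)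
    _ = n := by rw [← Finset.sum_mul, stdSimplex.sum_eq_one, one_mul]

theorem HasVisits.le_expVisits {M : MDP S A} {π : Policy S A} {N : ℕ} {p : ℝ}
    (h : HasVisits (pairMatrix M π) N p) (s : S) (j : S × A) : p ≤ expVisits M π N s j := by
  calc p = ∑ a, π s a * p := by rw [← Finset.sum_mul, stdSimplex.sum_eq_one, one_mul]
    _ ≤ _ := Finset.sum_le_sum fun a _ =>
        mul_le_mul_of_nonneg_left (h _ _) (stdSimplex.zero_le (π s) a)

end ExpectedVisits

/-! ### Expectations along the trajectory -/

section Expectation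

variable {S A : Type*} [Fintype S] [DecidableEq S] [Fintype A] [DecidableEq A] [Nonempty A]

/-- The conditional expectation of `f (Q', s')` after one iteration with step size `α` from the
table `Q` and the state `s`. -/
noncomputable def iterOp (M : MDP S A) (π : Policy S A) (γ lam α : ℝ) (f : (S → A → ℝ) → S → ℝ)
    (Q : S → A → ℝ) (s : S) : ℝ :=
  ∑ a, π s a * ∑ u, M.P s a u * f (softQStep M γ lam α Q s a u) u

/-- The conditional expectation of `f` after the `n` iterations starting at time `t`. -/
noncomputable def blockOp (M : MDP S A) (π : Policy S A) (γ lam : ℝ) (α : ℕ → ℝ) :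
    ℕ → ℕ → ((S → A → ℝ) → S → ℝ) → (S → A → ℝ) → S → ℝ
  | _, 0, f => f
  | t, n + 1, f => iterOp M π γ lam (α t) (blockOp M π γ lam α (t + 1) n f)

/-- The expectation of a function of the table and the state after `n` iterations. -/
noncomputable def trajExp (M : MDP S A) (π : Policy S A) (ρ : stdSimplex ℝ S) (γ lam : ℝ)
    (α : ℕ → ℝ) (n : ℕ) (f : (S → A → ℝ) → S → ℝ) : ℝ :=
  ∑ ω : Traj S A n, trajProb M π ρ ω * f (softQ M γ lam α n ω) (ω.1 (Fin.last n))

/-- The Markov property: the last action and state are split off the trajectory and summed first. -/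
theorem trajExp_succ (M : MDP S A) (π : Policy S A) (ρ : stdSimplex ℝ S) (γ lam : ℝ)
    (α : ℕ → ℝ) (n : ℕ) (f : (S → A → ℝ) → S → ℝ) :
    trajExp M π ρ γ lam α (n + 1) f = trajExp M π ρ γ lam α n (iterOp M π γ lam (α n) f) := by
  unfold trajExp
  rw [Fintype.sum_prod_type, Fintype.sum_prod_type,
    ← (Fin.snocEquiv fun _ : Fin (n + 1 + 1) => S).sum_comp, Fintype.sum_prod_type,
    Finset.sum_comm]
  refine Finset.sum_congr rfl fun s _ => ?_
  rw [Finset.sum_comm, ← (Fin.snocEquiv fun _ : Fin (n + 1) => A).sum_comp,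
    Fintype.sum_prod_type, Finset.sum_comm]
  refine Finset.sum_congr rfl fun a _ => ?_
  have key : ∀ (s' : S) (a' : A),
      trajProb M π ρ ((Fin.snocEquiv fun _ : Fin (n + 1 + 1) => S) (s', s),
        (Fin.snocEquiv fun _ : Fin (n + 1) => A) (a', a))
      = trajProb M π ρ (s, a) * (π (s (Fin.last n)) a' * M.P (s (Fin.last n)) a' s') := by
    intro s' a'
    have h0 : (Fin.snoc s s' : Fin (n + 1 + 1) → S) 0 = s 0 :=
      Fin.snoc_castSucc (α := fun _ => S) s' s 0
    simp only [trajProb, Fin.snocEquiv_apply, Fin.prod_univ_castSucc, Fin.snoc_castSucc,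
      Fin.snoc_last, Fin.succ_last, Fin.succ_castSucc, h0, mul_assoc]
  have hQ : ∀ (s' : S) (a' : A),
      softQ M γ lam α (n + 1) ((Fin.snocEquiv fun _ : Fin (n + 1 + 1) => S) (s', s),
        (Fin.snocEquiv fun _ : Fin (n + 1) => A) (a', a))
      = softQStep M γ lam (α n) (softQ M γ lam α n (s, a)) (s (Fin.last n)) a' s' := by
    intro s' a'
    simp only [softQ, Traj.init, Fin.snocEquiv_apply, Fin.snoc_castSucc, Fin.snoc_last]
  simp only [key, hQ, iterOp, Finset.mul_sum]
  simp only [Fin.snocEquiv_apply, Fin.snoc_last, mul_assoc]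

theorem trajExp_add (M : MDP S A) (π : Policy S A) (ρ : stdSimplex ℝ S) (γ lam : ℝ)
    (α : ℕ → ℝ) (t n : ℕ) (f : (S → A → ℝ) → S → ℝ) :
    trajExp M π ρ γ lam α (t + n) f
      = trajExp M π ρ γ lam α t (blockOp M π γ lam α t n f) := by
  induction n generalizing t with
  | zero => rfl
  | succ n ih => rw [show t + (n + 1) = t + 1 + n by ring, ih, trajExp_succ]; rfl

variable {M : MDP S A} {γ lam R : ℝ}

theorem abs_td_target_le (hγ0 : 0 ≤ γ) (hγ1 : γ < 1) (hlam : 0 < lam)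
    (hr : ∀ s a, |M.r s a| ≤ R) {Q : S → A → ℝ} (hQ : ∀ s a, |Q s a| ≤ tableBound A γ lam R)
    (s : S) (a : A) (s' : S) :
    |M.r s a + γ * softValue lam (Q s')| ≤ tableBound A γ lam R := by
  rw [← tableBound_eq (lam := lam) (R := R) hγ1]
  refine (abs_add_le _ _).trans (add_le_add (hr s a) ?_)
  rw [abs_mul, abs_of_nonneg hγ0]
  gcongr
  exact abs_softValue_le hlam (hQ s')

theorem abs_softQStep_le (hγ0 : 0 ≤ γ) (hγ1 : γ < 1) (hlam : 0 < lam)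
    (hr : ∀ s a, |M.r s a| ≤ R) {Q : S → A → ℝ} (hQ : ∀ s a, |Q s a| ≤ tableBound A γ lam R)
    {α : ℝ} (hα0 : 0 ≤ α) (hα1 : α ≤ 1) (s : S) (a : A) (s' : S) (s₁ : S) (a₁ : A) :
    |softQStep M γ lam α Q s a s' s₁ a₁| ≤ tableBound A γ lam R := by
  unfold softQStep
  split_ifs
  · have h1 := abs_le.1 (abs_td_target_le hγ0 hγ1 hlam hr hQ s a s')
    have h2 := abs_le.1 (hQ s a)
    change |Q s a + α * (M.r s a + γ * softValue lam (Q s') - Q s a)| ≤ _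
    rw [abs_le]
    constructor <;> nlinarith
  · exact hQ s₁ a₁

theorem abs_softQ_le (hγ0 : 0 ≤ γ) (hγ1 : γ < 1) (hlam : 0 < lam) (hR : 0 ≤ R)
    (hr : ∀ s a, |M.r s a| ≤ R) {α : ℕ → ℝ} (hα0 : ∀ t, 0 ≤ α t) (hα1 : ∀ t, α t ≤ 1) (n : ℕ)
    (ω : Traj S A n) (s : S) (a : A) : |softQ M γ lam α n ω s a| ≤ tableBound A γ lam R := by
  induction n generalizing s a with
  | zero => simpa [softQ] using tableBound_nonneg (A := A) hγ0 hγ1 hlam hR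
  | succ n ih =>
    exact abs_softQStep_le hγ0 hγ1 hlam hr (ih ω.init) (hα0 n) (hα1 n) _ _ _ s a

/-- Expectations are monotone in functions compared on bounded tables. -/
theorem trajExp_mono (hγ0 : 0 ≤ γ) (hγ1 : γ < 1) (hlam : 0 < lam) (hR : 0 ≤ R)
    (hr : ∀ s a, |M.r s a| ≤ R) {α : ℕ → ℝ} (hα0 : ∀ t, 0 ≤ α t) (hα1 : ∀ t, α t ≤ 1)
    (π : Policy S A) (ρ : stdSimplex ℝ S) (n : ℕ) {f g : (S → A → ℝ) → S → ℝ}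
    (h : ∀ Q s, (∀ s a, |Q s a| ≤ tableBound A γ lam R) → f Q s ≤ g Q s) :
    trajExp M π ρ γ lam α n f ≤ trajExp M π ρ γ lam α n g :=
  Finset.sum_le_sum fun ω _ => mul_le_mul_of_nonneg_left
    (h _ _ (abs_softQ_le hγ0 hγ1 hlam hR hr hα0 hα1 n ω)) (trajProb_nonneg M π ρ ω)

theorem trajExp_affine (M : MDP S A) (π : Policy S A) (ρ : stdSimplex ℝ S) (γ lam : ℝ)
    (α : ℕ → ℝ) (n : ℕ) (f : (S → A → ℝ) → S → ℝ) (c d : ℝ) :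
    trajExp M π ρ γ lam α n (fun Q s => c * f Q s + d) = c * trajExp M π ρ γ lam α n f + d := by
  simp only [trajExp, mul_add, Finset.sum_add_distrib, ← Finset.sum_mul, sum_trajProb, one_mul,
    Finset.mul_sum]
  congr 1
  exact Finset.sum_congr rfl fun _ _ => by ring

end Expectation

/-! ### Drift of the power potential -/

section Drift

variable {S A : Type*} [Fintype S] [DecidableEq S] [Fintype A] [DecidableEq A] [Nonempty A]

/-- The potential `∑ (s, a), (Q s a - Qs s a) ^ (2 * j + 2)`. -/
def powPotential (j : ℕ) (Qs Q : S → A → ℝ) : ℝ :=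
  ∑ i : S × A, (Q i.1 i.2 - Qs i.1 i.2) ^ (2 * j + 2)

theorem even_pow_nonneg (j : ℕ) (x : ℝ) : 0 ≤ x ^ (2 * j + 2) :=
  Even.pow_nonneg ⟨j + 1, by ring⟩ x

theorem powPotential_nonneg (j : ℕ) (Qs Q : S → A → ℝ) : 0 ≤ powPotential j Qs Q :=
  Finset.sum_nonneg fun _ _ => even_pow_nonneg j _

/-- The link between the sup norm, in which the Bellman operator contracts, and the potential. -/
theorem exists_sup_le_powPotential [Nonempty S] (j : ℕ) (Qs Q : S → A → ℝ) :
    ∃ d : ℝ, 0 ≤ d ∧ (∀ s a, |Q s a - Qs s a| ≤ d) ∧ d ^ (2 * j + 2) ≤ powPotential j Qs Q := by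
  obtain ⟨i, hi⟩ := Finite.exists_max fun i : S × A => |Q i.1 i.2 - Qs i.1 i.2|
  refine ⟨_, abs_nonneg _, fun s a => hi (s, a), ?_⟩
  rw [Even.pow_abs ⟨j + 1, by ring⟩]
  exact Finset.single_le_sum (f := fun i : S × A => (Q i.1 i.2 - Qs i.1 i.2) ^ (2 * j + 2))
    (fun _ _ => even_pow_nonneg j _) (Finset.mem_univ i)

theorem powPotential_le {B : ℝ} (j : ℕ) {Qs Q : S → A → ℝ} (hs : ∀ s a, |Qs s a| ≤ B)
    (hQ : ∀ s a, |Q s a| ≤ B) :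
    powPotential j Qs Q ≤ Fintype.card (S × A) * (2 * B) ^ (2 * j + 2) := by
  have : ∀ i ∈ (Finset.univ : Finset (S × A)),
      (Q i.1 i.2 - Qs i.1 i.2) ^ (2 * j + 2) ≤ (2 * B) ^ (2 * j + 2) := fun i _ => by
    rw [← Even.pow_abs ⟨j + 1, by ring⟩]
    refine pow_le_pow_left₀ (abs_nonneg _) ((abs_sub _ _).trans ?_) _
    linarith [hs i.1 i.2, hQ i.1 i.2]
  simpa [powPotential] using Finset.sum_le_card_nsmul _ _ _ this

variable {M : MDP S A} {γ lam R : ℝ}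

/-- The temporal difference of the transition `s, a, s'`. -/
noncomputable def tdError (M : MDP S A) (γ lam : ℝ) (Q : S → A → ℝ) (s : S) (a : A) (s' : S) : ℝ :=
  M.r s a + γ * softValue lam (Q s') - Q s a

/-- The added `1` keeps the bound positive, as the power inequalities require. -/
theorem abs_tdError_le (hγ0 : 0 ≤ γ) (hγ1 : γ < 1) (hlam : 0 < lam)
    (hr : ∀ s a, |M.r s a| ≤ R) {Q : S → A → ℝ} (hQ : ∀ s a, |Q s a| ≤ tableBound A γ lam R)
    (s : S) (a : A) (s' : S) : |tdError M γ lam Q s a s'| ≤ 2 * tableBound A γ lam R + 1 := by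
  refine (abs_sub _ _).trans ?_
  linarith [abs_td_target_le hγ0 hγ1 hlam hr hQ s a s', hQ s a]

theorem sum_tdError (M : MDP S A) (γ lam : ℝ) (Q : S → A → ℝ) (s : S) (a : A) :
    ∑ s', M.P s a s' * tdError M γ lam Q s a s' = softBellman M γ lam Q s a - Q s a := by
  have : ∀ s', M.P s a s' * tdError M γ lam Q s a s' = M.P s a s' * (M.r s a - Q s a)
      + γ * (M.P s a s' * softValue lam (Q s')) := fun s' => by rw [tdError]; ring
  simp only [this, Finset.sum_add_distrib, ← Finset.sum_mul, ← Finset.mul_sum,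
    stdSimplex.sum_eq_one, softBellman]
  ring

theorem softQStep_apply (M : MDP S A) (γ lam α : ℝ) (Q : S → A → ℝ) (s : S) (a : A) (s' : S)
    (i : S × A) : softQStep M γ lam α Q s a s' i.1 i.2
      = Q i.1 i.2 + α * if i = (s, a) then tdError M γ lam Q s a s' else 0 := by
  obtain ⟨s₁, a₁⟩ := i
  simp only [softQStep, Prod.mk.injEq]
  split_ifs with h
  · rw [h.1, h.2]; rfl
  · simp

theorem powPotential_softQStep (j : ℕ) (α : ℝ) (Qs Q : S → A → ℝ) (s : S) (a : A) (s' : S) :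
    powPotential j Qs (softQStep M γ lam α Q s a s') = powPotential j Qs Q
      - (Q s a - Qs s a) ^ (2 * j + 2)
      + (Q s a - Qs s a + α * tdError M γ lam Q s a s') ^ (2 * j + 2) := by
  unfold powPotential
  rw [← Finset.add_sum_erase _ _ (Finset.mem_univ (s, a)),
    ← Finset.add_sum_erase (a := (s, a)) _ (fun i : S × A => (Q i.1 i.2 - Qs i.1 i.2) ^ (2 * j + 2))
      (Finset.mem_univ (s, a))]
  have e : ∀ i ∈ Finset.univ.erase (s, a),
      (softQStep M γ lam α Q s a s' i.1 i.2 - Qs i.1 i.2) ^ (2 * j + 2)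
        = (Q i.1 i.2 - Qs i.1 i.2) ^ (2 * j + 2) := fun i hi => by
    rw [softQStep_apply, if_neg (Finset.ne_of_mem_erase hi), mul_zero, add_zero]
  rw [Finset.sum_congr rfl e, softQStep_apply]
  simp only [if_true]
  ring

/-- Expected decrease of the potential in one iteration, given the state-action pair. -/
theorem sum_powPotential_softQStep_le (hγ0 : 0 ≤ γ) (hγ1 : γ < 1) (hlam : 0 < lam)
    (hr : ∀ s a, |M.r s a| ≤ R) {j : ℕ} {ε C : ℝ}
    (hC : ∀ x w α : ℝ, |w| ≤ 2 * tableBound A γ lam R + 1 → 0 ≤ α → α ≤ 1 →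
      (x + α * w) ^ (2 * j + 2) ≤ x ^ (2 * j + 2) + (2 * j + 2) * x ^ (2 * j + 1) * (α * w)
        + ε * α * x ^ (2 * j + 2) + C * α ^ (j + 2))
    (hε : 0 ≤ ε) {Qs : S → A → ℝ} (hQs : softBellman M γ lam Qs = Qs)
    {Q : S → A → ℝ} (hQ : ∀ s a, |Q s a| ≤ tableBound A γ lam R) {α : ℝ} (hα0 : 0 ≤ α)
    (hα1 : α ≤ 1) (s : S) (a : A) :
    ∑ s', M.P s a s' * powPotential j Qs (softQStep M γ lam α Q s a s')
      ≤ (1 + α * (γ ^ (2 * j + 2) + ε)) * powPotential j Qs Q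
        - α * (Q s a - Qs s a) ^ (2 * j + 2) + C * α ^ (j + 2) := by
  have : Nonempty S := ⟨s⟩
  obtain ⟨d, hd0, hd, hdV⟩ := exists_sup_le_powPotential j Qs Q
  set x := Q s a - Qs s a with hx
  set V := powPotential j Qs Q with hV
  have hxV : x ^ (2 * j + 2) ≤ V :=
    Finset.single_le_sum (f := fun i : S × A => (Q i.1 i.2 - Qs i.1 i.2) ^ (2 * j + 2))
      (fun _ _ => even_pow_nonneg j _) (Finset.mem_univ (s, a))
  have h1 : ∀ s', M.P s a s' * powPotential j Qs (softQStep M γ lam α Q s a s')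
      ≤ M.P s a s' * (V + ε * α * x ^ (2 * j + 2) + C * α ^ (j + 2))
        + (2 * j + 2) * x ^ (2 * j + 1) * α * (M.P s a s' * tdError M γ lam Q s a s') := fun s' => by
    have := mul_le_mul_of_nonneg_left (hC x (tdError M γ lam Q s a s') α
      (abs_tdError_le hγ0 hγ1 hlam hr hQ s a s') hα0 hα1) (stdSimplex.zero_le (M.P s a) s')
    rw [powPotential_softQStep, ← hx, ← hV]
    linarith
  refine (Finset.sum_le_sum fun s' _ => h1 s').trans ?_
  rw [Finset.sum_add_distrib, ← Finset.sum_mul, stdSimplex.sum_eq_one, ← Finset.mul_sum,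
    sum_tdError]
  -- The mean drift is `e - x` with `e` the difference of the Bellman images, and `|e| ≤ γ * d` by
  -- contraction.
  have h2 := even_pow_tangent j x (softBellman M γ lam Q s a - softBellman M γ lam Qs s a) (γ * d)
    (abs_softBellman_sub_le hγ0 hlam hd s a)
  have e : softBellman M γ lam Q s a - softBellman M γ lam Qs s a - x
      = softBellman M γ lam Q s a - Q s a := by rw [hQs, hx]; ring
  rw [e, mul_pow] at h2
  have h3 : γ ^ (2 * j + 2) * d ^ (2 * j + 2) ≤ γ ^ (2 * j + 2) * V := by gcongr
  have h4 := mul_le_mul_of_nonneg_left (h2.trans (sub_le_sub_right h3 _)) hα0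
  have h5 : ε * α * x ^ (2 * j + 2) ≤ ε * α * V := by gcongr
  linarith

/-- The potential decreases over a block of iterations in proportion to the expected numbers of
visits. -/
theorem blockOp_powPotential_le (hγ0 : 0 ≤ γ) (hγ1 : γ < 1) (hlam : 0 < lam)
    (hr : ∀ s a, |M.r s a| ≤ R) {j : ℕ} {ε C₁ C₂ : ℝ} (hε : 0 ≤ ε) (hC₁0 : 0 ≤ C₁) (hC₂0 : 0 ≤ C₂)
    (hC₁ : ∀ x w α : ℝ, |w| ≤ 2 * tableBound A γ lam R + 1 → 0 ≤ α → α ≤ 1 →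
      (x + α * w) ^ (2 * j + 2) ≤ x ^ (2 * j + 2) + (2 * j + 2) * x ^ (2 * j + 1) * (α * w)
        + ε * α * x ^ (2 * j + 2) + C₁ * α ^ (j + 2))
    (hC₂ : ∀ x w α : ℝ, |w| ≤ 2 * tableBound A γ lam R + 1 → 0 ≤ α → α ≤ 1 →
      (1 - ε) * x ^ (2 * j + 2) - C₂ * α ^ (j + 1) ≤ (x + α * w) ^ (2 * j + 2))
    {Qs : S → A → ℝ} (hQs : softBellman M γ lam Qs = Qs) (π : Policy S A) {α : ℕ → ℝ} {N : ℕ}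
    {b a D : ℝ} (hb : b = 4 * (γ ^ (2 * j + 2) + ε) + N * ε)
    (hD : D = 2 ^ (j + 3) * C₁ + N * (Fintype.card (S × A) * (C₂ * 2 ^ (j + 1))))
    (ha0 : 0 ≤ a) (ha1 : 2 * a ≤ 1) (hba : N * b * a ≤ 1) (n : ℕ) (hn : n ≤ N) (t : ℕ)
    (hα : ∀ l < n, a ≤ α (t + l) ∧ α (t + l) ≤ 2 * a)
    (Q : S → A → ℝ) (hQ : ∀ s a, |Q s a| ≤ tableBound A γ lam R) (s : S) :
    blockOp M π γ lam α t n (fun Q _ => powPotential j Qs Q) Q s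
      ≤ (1 + n * b * a) * powPotential j Qs Q
        - a * ∑ i : S × A, expVisits M π n s i * (Q i.1 i.2 - Qs i.1 i.2) ^ (2 * j + 2)
        + n * D * a ^ (j + 2) := by
  have hg0 : 0 ≤ γ ^ (2 * j + 2) := by positivity
  have hb0 : 0 ≤ b := by rw [hb]; positivity
  -- The first iteration is peeled off. In `b`, the factor `4` is a `2` from step sizes up to `2 *
  -- a`, doubled by the cross term with `n * b * a ≤ 1`; `N * ε` is the cost of comparing later
  -- errors with those of the initial table. The two parts of `D` are the noise of these two
  -- estimates.
  induction n generalizing t Q s with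
  | zero => simp [blockOp, expVisits]
  | succ n ih =>
    set V := powPotential j Qs Q with hV
    have hV0 : 0 ≤ V := powPotential_nonneg j Qs Q
    obtain ⟨hα1, hα2⟩ := hα 0 n.succ_pos
    rw [add_zero] at hα1 hα2
    have hαt0 : 0 ≤ α t := ha0.trans hα1
    have hαt1 : α t ≤ 1 := hα2.trans ha1
    have hnN : (n : ℝ) ≤ N := by exact_mod_cast (Nat.le_succ n).trans hn
    have hnba : (n : ℝ) * b * a ≤ 1 := le_trans (by gcongr) hba
    have hnba0 : 0 ≤ (n : ℝ) * b * a := by positivity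
    have hact : ∀ c : A, ∑ s', M.P s c s' * blockOp M π γ lam α (t + 1) n
          (fun Q _ => powPotential j Qs Q) (softQStep M γ lam (α t) Q s c s') s'
        ≤ (1 + (n + 1 : ℕ) * b * a) * V
          - a * ∑ i : S × A, (∑ l ∈ Finset.range (n + 1), pairMatrix M π ^ l) (s, c) i
            * (Q i.1 i.2 - Qs i.1 i.2) ^ (2 * j + 2)
          + (n + 1 : ℕ) * D * a ^ (j + 2) := by
      intro c
      have h1 : ∀ s', blockOp M π γ lam α (t + 1) n
          (fun Q _ => powPotential j Qs Q) (softQStep M γ lam (α t) Q s c s') s'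
          ≤ (1 + n * b * a) * powPotential j Qs (softQStep M γ lam (α t) Q s c s')
            - a * ∑ i : S × A, expVisits M π n s' i * (Q i.1 i.2 - Qs i.1 i.2) ^ (2 * j + 2)
            + (a * (N * ε) * V
              + N * (Fintype.card (S × A) * (C₂ * 2 ^ (j + 1))) * a ^ (j + 2)
              + n * D * a ^ (j + 2)) := by
        intro s'
        have h2 := ih ((Nat.le_succ n).trans hn) (t + 1)
          (fun l hl => by
            have := hα (l + 1) (by lia)
            rwa [show t + (l + 1) = t + 1 + l by ring] at this)
          (softQStep M γ lam (α t) Q s c s')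
          (abs_softQStep_le hγ0 hγ1 hlam hr hQ hαt0 hαt1 s c s') s'
        -- The induction hypothesis weighs the visits with the errors after the first update; `hC₂`
        -- brings them back to those of `Q`.
        have h3 : ∀ i : S × A, expVisits M π n s' i * (Q i.1 i.2 - Qs i.1 i.2) ^ (2 * j + 2)
            - N * ε * (Q i.1 i.2 - Qs i.1 i.2) ^ (2 * j + 2)
            - N * (C₂ * (2 * a) ^ (j + 1))
            ≤ expVisits M π n s' i
              * (softQStep M γ lam (α t) Q s c s' i.1 i.2 - Qs i.1 i.2) ^ (2 * j + 2) := by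
          intro i
          have hw : |if i = (s, c) then tdError M γ lam Q s c s' else 0|
              ≤ 2 * tableBound A γ lam R + 1 := by
            have := abs_tdError_le hγ0 hγ1 hlam hr hQ s c s'
            split_ifs
            · exact this
            · rw [abs_zero]; exact (abs_nonneg _).trans this
          have h4 := hC₂ (Q i.1 i.2 - Qs i.1 i.2) _ (α t) hw hαt0 hαt1
          have hφ0 := expVisits_nonneg M π n s' i
          have hφ : expVisits M π n s' i ≤ N := (expVisits_le M π n s' i).trans hnN
          rw [softQStep_apply, add_sub_right_comm]
          have h5 := mul_le_mul_of_nonneg_left h4 hφ0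
          have h6 : C₂ * α t ^ (j + 1) ≤ C₂ * (2 * a) ^ (j + 1) := by gcongr
          have h7 : expVisits M π n s' i * (C₂ * α t ^ (j + 1)) ≤ N * (C₂ * (2 * a) ^ (j + 1)) := by
            gcongr
          have h8 : expVisits M π n s' i * (ε * (Q i.1 i.2 - Qs i.1 i.2) ^ (2 * j + 2))
              ≤ N * (ε * (Q i.1 i.2 - Qs i.1 i.2) ^ (2 * j + 2)) := by
            have := even_pow_nonneg j (Q i.1 i.2 - Qs i.1 i.2)
            gcongr
          linarith
        have h9 := Finset.sum_le_sum fun i (_ : i ∈ Finset.univ) => h3 i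
        rw [Finset.sum_sub_distrib, Finset.sum_sub_distrib, ← Finset.mul_sum, Finset.sum_const,
          Finset.card_univ, nsmul_eq_mul] at h9
        change _ - N * ε * V - _ ≤ _ at h9
        have h10 := mul_le_mul_of_nonneg_left h9 ha0
        have e : a * (Fintype.card (S × A) * (N * (C₂ * (2 * a) ^ (j + 1))))
            = N * (Fintype.card (S × A) * (C₂ * 2 ^ (j + 1))) * a ^ (j + 2) := by
          rw [mul_pow]; ring
        linarith
      have h11 := Finset.sum_le_sum fun s' (_ : s' ∈ Finset.univ) =>
        mul_le_mul_of_nonneg_left (h1 s') (stdSimplex.zero_le (M.P s c) s')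
      refine h11.trans ?_
      simp only [mul_add, mul_sub, Finset.sum_add_distrib, Finset.sum_sub_distrib]
      rw [← Finset.sum_mul, ← Finset.sum_mul, ← Finset.sum_mul, stdSimplex.sum_eq_one]
      have e1 : ∑ s', M.P s c s' * ((1 + n * b * a)
            * powPotential j Qs (softQStep M γ lam (α t) Q s c s'))
          = (1 + n * b * a) * ∑ s', M.P s c s'
            * powPotential j Qs (softQStep M γ lam (α t) Q s c s') := by
        rw [Finset.mul_sum]
        exact Finset.sum_congr rfl fun _ _ => by ring
      have e2 : ∑ i : S × A, (∑ l ∈ Finset.range (n + 1), pairMatrix M π ^ l) (s, c) i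
            * (Q i.1 i.2 - Qs i.1 i.2) ^ (2 * j + 2)
          = (Q s c - Qs s c) ^ (2 * j + 2) + ∑ s', M.P s c s' * ∑ i : S × A,
            expVisits M π n s' i * (Q i.1 i.2 - Qs i.1 i.2) ^ (2 * j + 2) := by
        simp only [sum_pow_pairMatrix_succ, add_mul, Finset.sum_add_distrib, ite_mul, one_mul,
          zero_mul, Finset.sum_ite_eq, Finset.mem_univ, if_true]
        congr 1
        simp only [Finset.sum_mul, Finset.mul_sum]
        rw [Finset.sum_comm]
        exact Finset.sum_congr rfl fun _ _ => Finset.sum_congr rfl fun _ _ => by ring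
      have e3 : ∑ s', M.P s c s' * (a * ∑ i : S × A,
            expVisits M π n s' i * (Q i.1 i.2 - Qs i.1 i.2) ^ (2 * j + 2))
          = a * ∑ s', M.P s c s' * ∑ i : S × A,
            expVisits M π n s' i * (Q i.1 i.2 - Qs i.1 i.2) ^ (2 * j + 2) := by
        rw [Finset.mul_sum]
        exact Finset.sum_congr rfl fun _ _ => by ring
      rw [e1, e2, e3]
      have hone := sum_powPotential_softQStep_le hγ0 hγ1 hlam hr hC₁ hε hQs hQ hαt0 hαt1 s c
      rw [← hV] at hone
      have hx0 := even_pow_nonneg j (Q s c - Qs s c)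
      have h12 : (1 + α t * (γ ^ (2 * j + 2) + ε)) * V
          ≤ (1 + 2 * a * (γ ^ (2 * j + 2) + ε)) * V := by gcongr
      have h13 : a * (Q s c - Qs s c) ^ (2 * j + 2) ≤ α t * (Q s c - Qs s c) ^ (2 * j + 2) := by
        gcongr
      have h14 : C₁ * α t ^ (j + 2) ≤ C₁ * (2 * a) ^ (j + 2) := by gcongr
      have h15 := mul_le_mul_of_nonneg_left
        (hone.trans (show _ ≤ (1 + 2 * a * (γ ^ (2 * j + 2) + ε)) * V
          - a * (Q s c - Qs s c) ^ (2 * j + 2) + C₁ * (2 * a) ^ (j + 2) by linarith))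
        (show 0 ≤ 1 + n * b * a by linarith)
      have h16 : (1 + n * b * a) * (C₁ * (2 * a) ^ (j + 2)) ≤ 2 ^ (j + 3) * C₁ * a ^ (j + 2) := by
        calc (1 + n * b * a) * (C₁ * (2 * a) ^ (j + 2)) ≤ 2 * (C₁ * (2 * a) ^ (j + 2)) := by
              gcongr; linarith
          _ = _ := by rw [mul_pow]; ring
      have h17 : a * (Q s c - Qs s c) ^ (2 * j + 2)
          ≤ (1 + n * b * a) * (a * (Q s c - Qs s c) ^ (2 * j + 2)) :=
        le_mul_of_one_le_left (by positivity) (by linarith)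
      have h18 : (1 + n * b * a) * ((1 + 2 * a * (γ ^ (2 * j + 2) + ε)) * V)
          ≤ (1 + n * b * a + 4 * a * (γ ^ (2 * j + 2) + ε)) * V := by
        rw [← mul_assoc]
        refine mul_le_mul_of_nonneg_right ?_ hV0
        have : n * b * a * (2 * a * (γ ^ (2 * j + 2) + ε)) ≤ 1 * (2 * a * (γ ^ (2 * j + 2) + ε)) := by
          gcongr
        linarith
      have e4 : (1 + (n + 1 : ℕ) * b * a) * V = (1 + n * b * a + 4 * a * (γ ^ (2 * j + 2) + ε)) * V
          + a * (N * ε) * V := by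
        push_cast
        rw [show ((n : ℝ) + 1) * b * a = n * b * a + b * a by ring]
        conv_lhs => rw [show b * a = 4 * a * (γ ^ (2 * j + 2) + ε) + a * (N * ε) by rw [hb]; ring]
        ring
      have e5 : ((n + 1 : ℕ) : ℝ) * D * a ^ (j + 2) = 2 ^ (j + 3) * C₁ * a ^ (j + 2)
          + N * (Fintype.card (S × A) * (C₂ * 2 ^ (j + 1))) * a ^ (j + 2)
          + n * D * a ^ (j + 2) := by
        push_cast
        rw [show ((n : ℝ) + 1) * D * a ^ (j + 2) = D * a ^ (j + 2) + n * D * a ^ (j + 2) by ring]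
        conv_lhs => rw [show D * a ^ (j + 2) = 2 ^ (j + 3) * C₁ * a ^ (j + 2)
          + N * (Fintype.card (S × A) * (C₂ * 2 ^ (j + 1))) * a ^ (j + 2) by rw [hD]; ring]
      rw [e4, e5]
      linarith
    have h := Finset.sum_le_sum fun c (_ : c ∈ Finset.univ) =>
      mul_le_mul_of_nonneg_left (hact c) (stdSimplex.zero_le (π s) c)
    change ∑ c, π s c * _ ≤ _
    refine h.trans (le_of_eq ?_)
    simp only [mul_add, mul_sub, Finset.sum_add_distrib, Finset.sum_sub_distrib]
    rw [← Finset.sum_mul, ← Finset.sum_mul, stdSimplex.sum_eq_one, one_mul, one_mul]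
    congr 2
    simp only [expVisits, Finset.sum_mul, Finset.mul_sum]
    rw [Finset.sum_comm]
    exact Finset.sum_congr rfl fun _ _ => Finset.sum_congr rfl fun _ _ => by ring

end Drift

/-! ### The convergence rate -/

section Rate

variable {S A : Type*} [Fintype S] [DecidableEq S] [Fintype A] [DecidableEq A] [Nonempty A]

theorem stepSize_nonneg {h t₀ : ℝ} (hh : 0 ≤ h) (ht : 0 ≤ t₀) (t : ℕ) : 0 ≤ stepSize h t₀ t := by
  unfold stepSize; positivity

theorem stepSize_le_one {h t₀ : ℝ} (hht : h ≤ t₀) (ht : 0 < t₀) (t : ℕ) :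
    stepSize h t₀ t ≤ 1 := by
  unfold stepSize
  rw [div_le_one (by positivity)]
  linarith [Nat.cast_nonneg (α := ℝ) t]

/-- The moment of order `2 * j + 2` of the error of the table after `t` iterations is of order
`t ^ (-(j + 1))`. -/
theorem exists_trajExp_powPotential_le (S A : Type*) [Fintype S] [DecidableEq S] [Fintype A]
    [DecidableEq A] [Nonempty A] {γ lam R p : ℝ} {N : ℕ} (hγ0 : 0 ≤ γ) (hγ1 : γ < 1)
    (hlam : 0 < lam) (hR : 0 ≤ R) (hN : 0 < N) (hp : 0 < p) :
    ∃ (j : ℕ) (h₀ : ℝ), 0 < h₀ ∧ ∀ h, h₀ ≤ h → ∃ t₁ : ℝ, h ≤ t₁ ∧ ∀ t₀, t₁ ≤ t₀ →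
      ∃ K : ℝ, 0 ≤ K ∧ ∀ (M : MDP S A) (πB : Policy S A) (Qs : S → A → ℝ),
        (∀ s a, |M.r s a| ≤ R) → HasVisits (pairMatrix M πB) N p →
        softBellman M γ lam Qs = Qs → ∀ (ρ : stdSimplex ℝ S) (t : ℕ),
          trajExp M πB ρ γ lam (stepSize h t₀) t (fun Q _ => powPotential j Qs Q)
            * (t + t₀) ^ (j + 1) ≤ K := by
  have hN' : (0 : ℝ) < N := by exact_mod_cast hN
  -- With this `j` and the `ε` below, each of `4 * N * γ ^ (2 * j + 2)` and `N * (4 + N) * ε` is at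
  -- most `p / 4`, so `N * b ≤ p / 2`: half of the decrease from visits survives.
  obtain ⟨j, hj⟩ := exists_pow_lt_of_lt_one (show 0 < p / (16 * N) by positivity) hγ1
  have hg : γ ^ (2 * j + 2) ≤ p / (16 * N) :=
    (pow_le_pow_of_le_one hγ0 hγ1.le (by lia)).trans hj.le
  have hg0 : 0 ≤ γ ^ (2 * j + 2) := by positivity
  set ε : ℝ := p / (4 * N * (4 + N)) with hε
  have hε0 : 0 < ε := by positivity
  have hB := tableBound_nonneg (A := A) hγ0 hγ1 hlam hR
  set B := tableBound A γ lam R with hBdef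
  obtain ⟨C₁, hC₁0, hC₁⟩ := exists_even_pow_add_le j (show 0 < 2 * B + 1 by linarith) hε0
  obtain ⟨C₂, hC₂0, hC₂⟩ := exists_le_even_pow_add j (show 0 < 2 * B + 1 by linarith) hε0
  obtain ⟨b, hb⟩ : ∃ b : ℝ, b = 4 * (γ ^ (2 * j + 2) + ε) + N * ε := ⟨_, rfl⟩
  obtain ⟨D, hD⟩ : ∃ D : ℝ, D = 2 ^ (j + 3) * C₁
      + N * (Fintype.card (S × A) * (C₂ * 2 ^ (j + 1))) := ⟨_, rfl⟩
  have hD0 : 0 ≤ D := by rw [hD]; positivity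
  have hNb : N * b ≤ p / 2 := by
    rw [le_div_iff₀ (by positivity)] at hg
    have : ε * (4 * N * (4 + N)) = p := div_mul_cancel₀ _ (by positivity)
    rw [hb]
    nlinarith
  refine ⟨j, ((j + 1 : ℕ) * N + 1) / (p / 4), by positivity, fun h hh => ?_⟩
  have hh0 : 0 < h := lt_of_lt_of_le (by positivity) hh
  rw [div_le_iff₀ (by positivity), mul_comm h] at hh
  have hph : 0 < p * h := by positivity
  -- `N` keeps the step sizes within a factor `2` over a block, `h` keeps them at most `1`, `p * h`
  -- gives `p * a ≤ 1` and `c * h ≤ t₀`, and `1` gives `1 ≤ t₀`.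
  refine ⟨N + h + p * h + 1, by linarith, fun t₀ ht => ?_⟩
  have hht : h ≤ t₀ := by linarith
  have ht0 : 0 < t₀ := by linarith
  obtain ⟨K, hK0, hK⟩ := exists_decay_of_block_recursion (j + 1) N hN (c := p / 4) (D := N * D)
    (h := h) (t₀ := t₀) (b := Fintype.card (S × A) * (2 * B) ^ (2 * j + 2)) (by positivity) hh
    hh0.le (by linarith) (by linarith) (by positivity)
  refine ⟨K, hK0, fun M πB Qs hr hvis hQs ρ t => ?_⟩
  have hα0 := stepSize_nonneg hh0.le ht0.le
  have hα1 := stepSize_le_one hht ht0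
  have hQsB := abs_le_tableBound_of_fixedPoint hγ0 hγ1 hlam hR hr hQs
  refine hK (fun t => trajExp M πB ρ γ lam (stepSize h t₀) t (fun Q _ => powPotential j Qs Q))
    (fun t => ?_) (fun t => ?_) t
  -- The constant is written as `0 * 0 + c` so that `trajExp_affine` evaluates its expectation.
  · refine (trajExp_mono hγ0 hγ1 hlam hR hr hα0 hα1 πB ρ t (g := fun Q s => 0 * 0
      + Fintype.card (S × A) * (2 * B) ^ (2 * j + 2)) fun Q _ hQ => ?_).trans ?_
    · rw [zero_mul, zero_add]; exact powPotential_le j hQsB hQ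
    · rw [trajExp_affine M πB ρ γ lam _ t (fun _ _ => 0)]; simp
  -- Half the first step size, so that all step sizes of the block lie in `[a, 2 * a]`. The
  -- surviving decrease `p / 2 * a` is `p / 4` times the step size.
  · set a : ℝ := stepSize h t₀ t / 2 with ha
    have ha0 : 0 ≤ a := by have := hα0 t; positivity
    have ha1 : 2 * a ≤ 1 := by have := hα1 t; rw [ha]; linarith
    have hX : 0 < (t : ℝ) + t₀ := by positivity
    have hpa : p * a ≤ 1 := by
      have : p * stepSize h t₀ t ≤ 1 := by
        rw [stepSize, mul_div_assoc', div_le_one hX]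
        linarith [Nat.cast_nonneg (α := ℝ) t]
      have := mul_nonneg hp.le ha0
      rw [ha] at this ⊢
      linarith
    have hα : ∀ l < N, a ≤ stepSize h t₀ (t + l) ∧ stepSize h t₀ (t + l) ≤ 2 * a := fun l hl => by
      have hlN : (l : ℝ) ≤ N := by exact_mod_cast hl.le
      have hl0 := Nat.cast_nonneg (α := ℝ) l
      have ht' := Nat.cast_nonneg (α := ℝ) t
      constructor
      · rw [ha, stepSize, stepSize, div_div]
        push_cast
        gcongr
        linarith
      · rw [ha, mul_div_cancel₀ _ two_ne_zero, stepSize, stepSize]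
        push_cast
        gcongr
        linarith
    rw [trajExp_add]
    refine (trajExp_mono hγ0 hγ1 hlam hR hr hα0 hα1 πB ρ t (g := fun Q s =>
      (1 - p / 4 * (h / (t + t₀))) * powPotential j Qs Q + N * D * (h / (t + t₀)) ^ (j + 1 + 1))
      fun Q s hQ => ?_).trans (trajExp_affine ..).le
    have hmain := blockOp_powPotential_le hγ0 hγ1 hlam hr hε0.le hC₁0 hC₂0 hC₁ hC₂ hQs πB hb hD ha0
      ha1 (by nlinarith) N le_rfl t hα Q hQ s
    refine hmain.trans ?_
    have hV0 := powPotential_nonneg j Qs Q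
    have h1 : p * powPotential j Qs Q ≤ ∑ i : S × A, expVisits M πB N s i
        * (Q i.1 i.2 - Qs i.1 i.2) ^ (2 * j + 2) := by
      rw [powPotential, Finset.mul_sum]
      exact Finset.sum_le_sum fun i _ =>
        mul_le_mul_of_nonneg_right (hvis.le_expVisits s i) (even_pow_nonneg j _)
    have h2 := mul_le_mul_of_nonneg_left h1 ha0
    have h3 : N * b * a * powPotential j Qs Q ≤ p / 2 * a * powPotential j Qs Q := by gcongr
    have e : h / (t + t₀) = 2 * a := by rw [ha, mul_div_cancel₀ _ two_ne_zero, stepSize]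
    have h4 : N * D * a ^ (j + 2) ≤ N * D * (2 * a) ^ (j + 2) := by
      gcongr
      linarith
    rw [e]
    change _ ≤ _ + N * D * (2 * a) ^ (j + 2)
    linarith

/-- An error `K / n` needs only about `K / δ ^ 2` iterations. For `δ < q` the factor `log (1 / δ)`
exceeds `log (1 / q) > 0` and is absorbed in the constant; for `δ ≥ q` the uniform bound `q ^ 2`
allows `T = 0`. -/
theorem softQRate_of_le {M : MDP S A} {γ lam : ℝ} {πB πstar : Policy S A} {h t₀ K q : ℝ}
    (hK : 0 ≤ K) (ht₀ : 0 < t₀) (hq0 : 0 < q) (hq1 : q < 1)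
    (h1 : ∀ ρ n, meanSqError πstar (trajLaw M πB ρ n) (softQPolicy M γ lam (stepSize h t₀) n)
      * (n + t₀) ≤ K)
    (h2 : ∀ ρ n, meanSqError πstar (trajLaw M πB ρ n) (softQPolicy M γ lam (stepSize h t₀) n)
      ≤ q ^ 2) : SoftQRate M γ lam πB πstar h t₀ ((K + 1) / Real.log (1 / q)) := by
  intro ρ δ hδ0 hδ1
  have hlog : ∀ x : ℝ, 0 < x → x < 1 → 0 < Real.log (1 / x) := fun x hx hx1 =>
    Real.log_pos (by rw [lt_div_iff₀ hx]; linarith)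
  have hlq := hlog q hq0 hq1
  have hlδ := hlog δ hδ0 hδ1
  rcases le_or_gt q δ with hqδ | hqδ
  · refine ⟨0, by rw [Nat.cast_zero]; positivity, fun n _ => (h2 ρ n).trans (by gcongr)⟩
  · have hδ2 : 0 < δ ^ 2 := by positivity
    refine ⟨⌈K / δ ^ 2⌉₊, ?_, fun n hn => ?_⟩
    · have e1 : (1 : ℝ) ≤ 1 / δ ^ 2 := by rw [le_div_iff₀ hδ2]; nlinarith
      calc (⌈K / δ ^ 2⌉₊ : ℝ) ≤ K / δ ^ 2 + 1 := (Nat.ceil_lt_add_one (by positivity)).le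
        _ ≤ K / δ ^ 2 + 1 / δ ^ 2 := by linarith
        _ = (K + 1) / Real.log (1 / q) * (Real.log (1 / q) / δ ^ 2) := by
            field_simp
        _ ≤ _ := by gcongr
    · have hKn : K ≤ δ ^ 2 * (n + t₀) := by
        have := (Nat.le_ceil _).trans (Nat.cast_le (α := ℝ).2 hn)
        rw [div_le_iff₀ hδ2] at this
        nlinarith
      exact le_of_mul_le_mul_right ((h1 ρ n).trans hKn) (by positivity)

/-- The convergence rate of soft Q-learning, with constants depending on the problem only through
the bound on the rewards and on the expected numbers of visits. -/
theorem exists_softQRate (S A : Type*) [Fintype S] [DecidableEq S] [Fintype A] [DecidableEq A]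
    [Nonempty A] {γ lam R p : ℝ} {N : ℕ} (hγ0 : 0 ≤ γ) (hγ1 : γ < 1)
    (hlam : 0 < lam) (hR : 0 ≤ R) (hN : 0 < N) (hp : 0 < p) :
    ∃ h₀ : ℝ, ∀ h, h₀ ≤ h → ∃ t₁ : ℝ, ∀ t₀, t₁ ≤ t₀ → ∃ C : ℝ,
      ∀ (M : MDP S A) (πB : Policy S A) (Qs : S → A → ℝ), (∀ s a, |M.r s a| ≤ R) →
        HasVisits (pairMatrix M πB) N p → softBellman M γ lam Qs = Qs →
        SoftQRate M γ lam πB (softmaxPolicy lam Qs) h t₀ C := by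
  obtain ⟨j, h₀, hh₀, H⟩ := exists_trajExp_powPotential_le S A hγ0 hγ1 hlam hR hN hp
  refine ⟨h₀, fun h hh => ?_⟩
  obtain ⟨t₁, ht₁, H⟩ := H h hh
  refine ⟨t₁, fun t₀ ht => ?_⟩
  obtain ⟨K, hK0, H⟩ := H t₀ ht
  have hh0 : 0 < h := hh₀.trans_le hh
  have hht : h ≤ t₀ := ht₁.trans ht
  have ht0 : 0 < t₀ := hh0.trans_le hht
  set B := tableBound A γ lam R with hB
  -- The maximum with `1 / 2` keeps `q` positive even when the other term is `0`.
  set q : ℝ := max (1 / 2) (1 - Real.exp (-(2 * B / lam)) / Fintype.card A) with hq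
  have hcard : (0 : ℝ) < Fintype.card A := by exact_mod_cast Fintype.card_pos
  have hq0 : 0 < q := lt_max_of_lt_left (by norm_num)
  have hq1 : q < 1 := max_lt (by norm_num) (by
    have : 0 < Real.exp (-(2 * B / lam)) / Fintype.card A := by positivity
    linarith)
  refine ⟨_, fun M πB Qs hr hvis hQs => softQRate_of_le (K := 4 / lam ^ 2 * (1 + K)) (by positivity)
    ht0 hq0 hq1 (fun ρ n => ?_) fun ρ n => ?_⟩
  all_goals
    have hα0 := stepSize_nonneg hh0.le ht0.le
    have hα1 := stepSize_le_one hht ht0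
    have hQsB := abs_le_tableBound_of_fixedPoint hγ0 hγ1 hlam hR hr hQs
    rw [show meanSqError (softmaxPolicy lam Qs) (trajLaw M πB ρ n)
        (softQPolicy M γ lam (stepSize h t₀) n) = trajExp M πB ρ γ lam (stepSize h t₀) n
      (fun Q _ => policyDist (softmaxPolicy lam Qs) (softmaxPolicy lam Q) ^ 2) from rfl]
  · have hX : 0 < (n : ℝ) + t₀ := by positivity
    set X : ℝ := (n : ℝ) + t₀ with hXdef
    have h1 := trajExp_mono hγ0 hγ1 hlam hR hr hα0 hα1 πB ρ n
      (f := fun Q _ => policyDist (softmaxPolicy lam Qs) (softmaxPolicy lam Q) ^ 2)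
      (g := fun Q s => 4 / lam ^ 2 / X * X ^ (j + 1) * powPotential j Qs Q + 4 / lam ^ 2 / X)
      fun Q s _ => by
        have : Nonempty S := ⟨s⟩
        obtain ⟨d, hd0, hd, hdV⟩ := exists_sup_le_powPotential j Qs Q
        have h2 := policyDist_softmaxPolicy_le hlam hd0
          fun s a => (abs_sub_comm (Qs s a) (Q s a)).trans_le (hd s a)
        have h3 : policyDist (softmaxPolicy lam Qs) (softmaxPolicy lam Q) ^ 2
            ≤ (2 * d / lam) ^ 2 := pow_le_pow_left₀ (norm_nonneg _) h2 2
        -- In place of Jensen's inequality, `y ≤ 1 + y ^ (j + 1)` at the scale `y = d ^ 2 * X`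
        -- passes from the high moment to the second one.
        have h4 : d ^ 2 * X ≤ 1 + (d ^ 2 * X) ^ (j + 1) := by
          have h5 : 0 ≤ d ^ 2 * X := by positivity
          rcases le_total (d ^ 2 * X) 1 with h6 | h6
          · have := pow_nonneg h5 (j + 1)
            linarith
          · have := le_self_pow₀ h6 (show j + 1 ≠ 0 by lia)
            linarith
        have h5 : (d ^ 2 * X) ^ (j + 1) ≤ X ^ (j + 1) * powPotential j Qs Q := by
          rw [mul_pow, ← pow_mul, mul_comm]
          gcongr
          exact hdV
        calc policyDist (softmaxPolicy lam Qs) (softmaxPolicy lam Q) ^ 2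
            ≤ (2 * d / lam) ^ 2 := h3
          _ = 4 / lam ^ 2 / X * (d ^ 2 * X) := by field_simp; ring
          _ ≤ 4 / lam ^ 2 / X * (1 + X ^ (j + 1) * powPotential j Qs Q) := by
              gcongr
              linarith
          _ = _ := by ring
    rw [trajExp_affine M πB ρ γ lam _ n (fun Q _ => powPotential j Qs Q)] at h1
    have h2 := H M πB Qs hr hvis hQs ρ n
    calc _ ≤ (4 / lam ^ 2 / X * X ^ (j + 1) * trajExp M πB ρ γ lam (stepSize h t₀) n
            (fun Q _ => powPotential j Qs Q) + 4 / lam ^ 2 / X) * X := by gcongr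
      _ = 4 / lam ^ 2 * (1 + trajExp M πB ρ γ lam (stepSize h t₀) n
            (fun Q _ => powPotential j Qs Q) * X ^ (j + 1)) := by field_simp; ring
      _ ≤ _ := by gcongr
  · refine (trajExp_mono hγ0 hγ1 hlam hR hr hα0 hα1 πB ρ n (g := fun Q s => 0 * 0 + q ^ 2)
      fun Q _ hQ => ?_).trans ?_
    · rw [zero_mul, zero_add]
      exact pow_le_pow_left₀ (norm_nonneg _)
        (policyDist_softmaxPolicy_le_of_bounded hlam hQsB hQ hq0.le (le_max_right _ _)) 2
    · rw [trajExp_affine M πB ρ γ lam _ n (fun _ _ => 0)]; simp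

theorem exists_isUniqueOptimal_softQRate {γ lam : ℝ} (hγ0 : 0 < γ) (hγ1 : γ < 1) (hlam : 0 < lam)
    (M : MDP S A) (πB : Policy S A) (hirr : (pairMatrix M πB).IsIrreducible) :
    ∃ πstar : Policy S A, IsUniqueOptimal M γ lam πstar ∧
      ∃ h₀ : ℝ, ∀ h, h₀ ≤ h → ∃ t₁ : ℝ, ∀ t₀, t₁ ≤ t₀ → ∃ C : ℝ,
        SoftQRate M γ lam πB πstar h t₀ C := by
  obtain ⟨Qs, hQs⟩ := exists_softBellman_fixedPoint M hγ0.le hγ1 hlam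
  obtain ⟨N, p, hN, hp, hvis⟩ := exists_hasVisits_of_isIrreducible hirr
  obtain ⟨h₀, H⟩ := exists_softQRate S A hγ0.le hγ1 hlam (norm_nonneg M.r) hN hp
  refine ⟨_, isUniqueOptimal_softmaxPolicy hγ0 hγ1 hlam hQs hirr, h₀, fun h hh => ?_⟩
  obtain ⟨t₁, H⟩ := H h hh
  refine ⟨t₁, fun t₀ ht => ?_⟩
  obtain ⟨C, H⟩ := H t₀ ht
  exact ⟨C, H M πB Qs
    (fun s a => (norm_le_pi_norm (M.r s) a).trans (norm_le_pi_norm M.r s)) hvis hQs⟩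

end Rate

/-! ### Assembly of the three claims. -/

theorem mainTheorem6 {S A X Ξ : Type*} [Fintype S] [DecidableEq S] [Fintype A] [DecidableEq A]
    [Nonempty A] (γ lam : ℝ) (hγ0 : 0 < γ) (hγ1 : γ < 1) (hlam : 0 < lam) :
    -- convergence with the stated rate for every ergodic behavioural policy
    (∀ (M : MDP S A) (πB : Policy S A), IsErgodicChain (pairMatrix M πB) →
      ∃ πstar : Policy S A, IsUniqueOptimal M γ lam πstar ∧
        ∃ h₀ : ℝ, ∀ h, h₀ ≤ h → ∃ t₁ : ℝ, ∀ t₀, t₁ ≤ t₀ → ∃ C : ℝ,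
          SoftQRate M γ lam πB πstar h t₀ C) ∧
    -- the constants depend on the problem only through the bound on the rewards, the minimal
    -- stationary probability and the mixing time
    (∀ (Rbar m : ℝ) (τ : ℕ), 0 < m →
      ∃ h₀ : ℝ, ∀ h, h₀ ≤ h → ∃ t₁ : ℝ, ∀ t₀, t₁ ≤ t₀ → ∃ C : ℝ,
        ∀ (M : MDP S A) (πB πstar : Policy S A), (∀ s a, |M.r s a| ≤ Rbar) →
          IsErgodicChain (pairMatrix M πB) → HasMixing (pairMatrix M πB) m τ →
          IsUniqueOptimal M γ lam πstar → SoftQRate M γ lam πB πstar h t₀ C) ∧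
    -- soft Q-learning is an inexact oracle for the contextual family
    (∀ (M : X → Ξ → MDP S A) (πB : X → Ξ → Policy S A),
      (∀ x ξ, IsErgodicChain (pairMatrix (M x ξ) (πB x ξ))) →
      ∃ (πstar : X → Ξ → Policy S A) (h t₀ C : X → Ξ → ℝ),
        (∀ x ξ, IsUniqueOptimal (M x ξ) γ lam (πstar x ξ) ∧ 0 < h x ξ ∧ 0 < t₀ x ξ) ∧
        ∀ (ρ : X → Ξ → stdSimplex ℝ S) (δ : ℝ), 0 < δ → δ < 1 →
          ∃ T : X → Ξ → ℕ, (∀ x ξ, (T x ξ : ℝ) ≤ C x ξ * (Real.log (1 / δ) / δ ^ 2)) ∧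
            IsInexactOracle πstar (fun x ξ => trajLaw (M x ξ) (πB x ξ) (ρ x ξ) (T x ξ))
              (fun x ξ => softQPolicy (M x ξ) γ lam (stepSize (h x ξ) (t₀ x ξ)) (T x ξ)) δ) := by
  refine ⟨fun M πB herg => exists_isUniqueOptimal_softQRate hγ0 hγ1 hlam M πB herg.1,
    fun Rbar m τ hm => ?_, fun M πB herg => ?_⟩
  · obtain ⟨N, hN, hvis⟩ := exists_hasVisits_of_hasMixing (S × A) hm τ
    -- `Rbar` may be negative, while a nonnegative reward bound is needed; hence `|Rbar|`.
    obtain ⟨h₀, H⟩ := exists_softQRate S A hγ0.le hγ1 hlam (abs_nonneg Rbar) hN (half_pos hm)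
    refine ⟨h₀, fun h hh => ?_⟩
    obtain ⟨t₁, H⟩ := H h hh
    refine ⟨t₁, fun t₀ ht => ?_⟩
    obtain ⟨C, H⟩ := H t₀ ht
    refine ⟨C, fun M πB πstar hr herg hmix hopt => ?_⟩
    obtain ⟨Qs, hQs⟩ := exists_softBellman_fixedPoint M hγ0.le hγ1 hlam
    -- By uniqueness the given maximizer is the softmax of the fixed point.
    rw [← hopt.2 _ (isUniqueOptimal_softmaxPolicy hγ0 hγ1 hlam hQs herg.1).1]
    exact H M πB Qs (fun s a => (hr s a).trans (le_abs_self _))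
      (hvis _ (pairMatrix_nonneg M πB) (pairMatrix_sum M πB) hmix) hQs
  · choose πstar hopt h₀ H using fun x ξ =>
      exists_isUniqueOptimal_softQRate hγ0 hγ1 hlam (M x ξ) (πB x ξ) (herg x ξ).1
    -- The maxima with `1` make `h` and `t₀` positive.
    choose t₁ H using fun x ξ => H x ξ (max (h₀ x ξ) 1) (le_max_left _ _)
    choose C H using fun x ξ => H x ξ (max (t₁ x ξ) 1) (le_max_left _ _)
    refine ⟨πstar, fun x ξ => max (h₀ x ξ) 1, fun x ξ => max (t₁ x ξ) 1, C, fun x ξ =>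
      ⟨hopt x ξ, lt_max_of_lt_right one_pos, lt_max_of_lt_right one_pos⟩, fun ρ δ hδ0 hδ1 => ?_⟩
    choose T hT hT' using fun x ξ => H x ξ (ρ x ξ) δ hδ0 hδ1
    exact ⟨T, hT, fun x ξ => hT' x ξ _ le_rfl⟩
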